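/- Notation. Let $d,k\in\mathbb N=\{1,2,\dots\}$. For $\mathcal X\subseteq\mathbb R^d$ put $\|\mathcal X\|:=\sup_{x\in\mathcal X}\|x\|_\infty\in[0,\infty]$ and let $\mathcal P(\mathcal X)$ be the set of Borel probability measures on $\mathcal X$. For $\phi:\mathbb R\to\mathbb R$ and $a_1,\dots,a_4\ge 0$ let $\mathcal G_k(a_1,a_2,a_3,a_4,\phi)$ be the class of functions $g:\mathbb R^d\to\mathbb R$ of the form $$g(x)=\sum_{i=1}^k\beta_i\,\phi(w_i\cdot x+b_i)+w_0\cdot x+b_0,\qquad \max_{i}\big(\|w_i\|_1\vee|b_i|\big)\le a_1,\ \ \max_i|\beta_i|\le a_2,\ \ |b_0|\le a_3,\ \ \|w_0\|_1\le a_4 .$$ With $\phi_{\mathsf R}(z)=z\vee 0$ and $\phi_{\mathsf S}(z)=(1+e^{-z})^{-1}$, and for $a>0$, let $$\mathcal G_k^{\mathsf R}(a):=\mathcal G_k(1,2k^{-1}a,a,a,\phi_{\mathsf R}),\qquad \mathcal G_k^{\mathsf S}(a):=\mathcal G_k(k^{1/2}\log k,\,2k^{-1}a,\,a,\,0,\,\phi_{\mathsf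 S}).$$ For a class $\mathcal F$ of functions, $\underline C(\mathcal F,\mathcal X):=\inf_{f\in\mathcal F,\,x\in\mathcal X}f(x)$ and $\bar C(\mathcal F,\mathcal X):=\sup_{f\in\mathcal F,\,x\in\mathcal X}f(x)$. For $h:\mathbb R\to\overline{\mathbb R}=[-\infty,\infty]$, $\mu,\nu\in\mathcal P(\mathcal X)$ and $X^n=(X_1,\dots,X_n)$, $Y^n=(Y_1,\dots,Y_n)$, with $X_1,\dots,X_n$ i.i.d. with law $\mu$ and $Y_1,\dots,Y_n$ i.i.d. with law $\nu$, put $$\mathsf D_{h,\mathcal F}(\mu,\nu):=\sup_{f\in\mathcal F}\ \mathbb E_\mu[f]-\mathbb E_\nu[h\circ f],\qquad \hat{\mathsf D}_{h,\mathcal F}(X^n,Y^n):=\sup_{f\in\mathcal F}\frac1n\sum_{i=1}^n\big[f(X_i)-h\circ f(Y_i)\big].$$ Theorem (Empirical estimation error bound). Let $a>0$, let $(\mathcal G_k)_k$ be one of the two families $(\mathcal G_k^{\mathsf R}(a))_k$, $(\mathcal G_k^{\mathsf S}(a))_k$, and let $h:\mathbb R\to\overline{\mathbb R}$, $R\in[0,\infty]$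 and $B\in[0,\infty)$, where $B$ plays the role of a constant depending only on $a$, $h$ and $R$. There is a constant $C>0$, depending only on $a$, $h$, $R$, $B$ and the choice of the family, such that the following holds for all $d\ge 1$ and all $\mathcal X\subseteq\mathbb R^d$ with $\|\mathcal X\|=R$. Suppose that, for every $k\in\mathbb N$, $h$ is finite and differentiable on $[\underline C(\mathcal G_k,\mathcal X),\bar C(\mathcal G_k,\mathcal X)]$ with derivative $h'$ (one-sided at end points) and $$\bar C(|h'\circ\mathcal G_k|,\mathcal X)\vee\bar C(|h\circ\mathcal G_k|,\mathcal X)\vee\bar C(|\mathcal G_k|,\mathcal X)\le B .$$ Then for all $k,n\in\mathbb N$ the estimator $\hat{\mathsf D}_{h,\mathcal G_k}(X^n,Y^n)$ is measurable (up to null sets), and $$\sup_{\mu,\nu\in\mathcal P(\mathcal X)}\mathbb E\Big[\big|\hat{\mathsf D}_{h,\mathcal G_k}(X^n,Y^n)-\mathsf D_{h,\mathcal G_k}(\mu,\nu)\big|\Big]\le C\,d^{3/2}\,n^{-1/2}.$$ In particular the bound does not depend on $k$. -/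

import Mathlib

open MeasureTheory ProbabilityTheory
open scoped ENNReal NNReal

noncomputable section

namespace NeuralEstimation

/-- Shallow networks `g(x) = ∑ i, β i * φ (w i ⬝ x + b i) + w₀ ⬝ x + b₀` on `ℝ^d` with `k` neurons,
with `‖w i‖₁ ∨ |b i| ≤ a₁`, `|β i| ≤ a₂`, `|b₀| ≤ a₃` and `‖w₀‖₁ ≤ a₄`. -/
def nnClass (d k : ℕ) (a₁ a₂ a₃ a₄ : ℝ) (φ : ℝ → ℝ) : Set ((Fin d → ℝ) → ℝ) :=
  {g | ∃ (β : Fin k → ℝ) (w : Fin k → Fin d → ℝ) (b : Fin k → ℝ) (w₀ : Fin d → ℝ) (b₀ : ℝ),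
    (∀ i, max (∑ j, |w i j|) |b i| ≤ a₁) ∧ (∀ i, |β i| ≤ a₂) ∧ |b₀| ≤ a₃ ∧
    (∑ j, |w₀ j|) ≤ a₄ ∧
    ∀ x, g x = ∑ i, β i * φ ((∑ j, w i j * x j) + b i) + (∑ j, w₀ j * x j) + b₀}

/-- The rectified linear unit. -/
def reluAct (z : ℝ) : ℝ := max z 0

/-- The class `G_k^S(a)` of networks with logistic sigmoid activation. -/
def sigmoidClass (a : ℝ) (d k : ℕ) : Set ((Fin d → ℝ) → ℝ) :=
  nnClass d k (Real.sqrt k * Real.log k) (2 * (k : ℝ)⁻¹ * a) a 0 Real.sigmoid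

/-- The class `G_k^R(a)` of ReLU networks. -/
def reluClass (a : ℝ) (d k : ℕ) : Set ((Fin d → ℝ) → ℝ) :=
  nnClass d k 1 (2 * (k : ℝ)⁻¹ * a) a a reluAct

/-- `‖𝒳‖ = sup_{x ∈ 𝒳} ‖x‖_∞`, with values in `[0, ∞]` (`Fin d → ℝ` carries the sup norm). -/
def setNorm {d : ℕ} (𝒳 : Set (Fin d → ℝ)) : ℝ≥0∞ := ⨆ x ∈ 𝒳, ‖x‖ₑ

/-- `sup_{f ∈ F, x ∈ 𝒳} f x`. -/
def upperC {E β : Type*} [CompleteLattice β] (F : Set (E → β)) (𝒳 : Set E) : β :=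
  ⨆ f ∈ F, ⨆ x ∈ 𝒳, f x

/-- `inf_{f ∈ F, x ∈ 𝒳} f x`. -/
def lowerC {E β : Type*} [CompleteLattice β] (F : Set (E → β)) (𝒳 : Set E) : β :=
  ⨅ f ∈ F, ⨅ x ∈ 𝒳, f x

/-- The real points of the closed interval from `inf_{f ∈ F, x ∈ 𝒳} f x` to
`sup_{f ∈ F, x ∈ 𝒳} f x`. -/
def valueInterval {E : Type*} (F : Set (E → ℝ)) (𝒳 : Set E) : Set ℝ :=
  {t : ℝ | lowerC ((fun f x => (f x : EReal)) '' F) 𝒳 ≤ (t : EReal) ∧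
    (t : EReal) ≤ upperC ((fun f x => (f x : EReal)) '' F) 𝒳}

/-- The extended-real-valued function `h` is finite and differentiable on `I`, with derivative `h'`
(one-sided at end points of an interval `I`). -/
def HasDerivOn (h : ℝ → EReal) (h' : ℝ → ℝ) (I : Set ℝ) : Prop :=
  ∀ t ∈ I, h t ≠ ⊤ ∧ h t ≠ ⊥ ∧ HasDerivWithinAt (fun s => (h s).toReal) (h' t) I t

/-- The expectation `E[f⁺] - E[f⁻]` of an extended-real-valued function. -/
def expect {α : Type*} [MeasurableSpace α] (μ : Measure α) (f : α → EReal) : EReal :=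
  ((∫⁻ x, (f x).toENNReal ∂μ : ℝ≥0∞) : EReal) - ((∫⁻ x, (-f x).toENNReal ∂μ : ℝ≥0∞) : EReal)

/-- The divergence `D_{h,F}(μ, ν) = sup_{f ∈ F} E_μ[f] - E_ν[h ∘ f]` of measures on `𝒳`. -/
def divergence {d : ℕ} {𝒳 : Set (Fin d → ℝ)} (h : ℝ → EReal) (F : Set ((Fin d → ℝ) → ℝ))
    (μ ν : Measure 𝒳) : EReal :=
  ⨆ f ∈ F, (expect μ (fun x => (f x : EReal)) - expect ν (fun x => h (f x)))

/-- The estimator `sup_{f ∈ F} (1/n) ∑ i, (f (x i) - h (f (y i)))`. -/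
def estimator {d : ℕ} {𝒳 : Set (Fin d → ℝ)} (h : ℝ → EReal) (F : Set ((Fin d → ℝ) → ℝ))
    {n : ℕ} (x y : Fin n → 𝒳) : EReal :=
  ⨆ f ∈ F, (((n : ℝ)⁻¹ : ℝ) : EReal) * ∑ i, ((f (x i) : EReal) - h (f (y i)))

end NeuralEstimation

end

/-! The difference of the two suprema is at most the uniform deviation of the empirical means of `f`
under `μ` plus that of `h ∘ f` under `ν`. Symmetrization (`lintegral_iSup_deviation_le`) reduces
each deviation to Rademacher averages. The classes are closed under multiplication by `c ∈ [0, 1]`,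
so the values they take on `𝒳` form a convex set. There `|h'| ≤ B`, so `h` agrees with a
`B`-Lipschitz function `ψ` (`exists_lipschitzWith_eq`), and the contraction principle removes `ψ`.

What remains is the Rademacher average of the networks. A signed sum is linear and the outer weights
satisfy `∑ |β i| ≤ 2a`, so a network costs no more than a few single neurons, whatever `k` is. A
neuron is a monotone function of an affine function with values in some `[0, M]`; by the layer-cake
formula it is an integral over `[0, M]` of indicators of half-spaces (`abs_signedSum_comp_le`).
Hence only the range of the activation matters, not the size of the inner weights, and this is what
makes the sigmoid bound independent of the growing factor `√k log k`.

Half-spaces in `ℝ^d` have VC dimension at most `d + 1` by Radon's theorem. The Sauer–Shelah bound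
and a random sampling argument give an entropy bound at every scale
(`two_mul_card_le_of_separated`), and chaining with Massart's inequality bounds their Rademacher
sums on `n` points by `20 (d + 1) √n` (`sum_abs_signedSum_indVec_le`). After division by `n` this is
linear in `d`, hence within the factor `d ^ (3/2)`. -/

namespace NeuralEstimation

/-! ### Rademacher sums: Massart's bound and contraction -/

variable {ι κ : Type*} [Fintype ι]

/-- The signed sum `∑ i, ε i * v i`. -/
def signedSum (ε : ι → ℤˣ) (v : ι → ℝ) : ℝ := ∑ i, ((ε i : ℤ) : ℝ) * v i

theorem signedSum_neg_left (ε : ι → ℤˣ) (v : ι → ℝ) :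
    signedSum (-ε) v = -signedSum ε v := by
  simp [signedSum]

theorem signedSum_sub (ε : ι → ℤˣ) (v w : ι → ℝ) :
    signedSum ε (fun i => v i - w i) = signedSum ε v - signedSum ε w := by
  simp [signedSum, mul_sub]

theorem signedSum_add (ε : ι → ℤˣ) (v w : ι → ℝ) :
    signedSum ε (fun i => v i + w i) = signedSum ε v + signedSum ε w := by
  simp [signedSum, mul_add, Finset.sum_add_distrib]

theorem signedSum_mul (ε : ι → ℤˣ) (c : ℝ) (v : ι → ℝ) :
    signedSum ε (fun i => c * v i) = c * signedSum ε v := by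
  simp only [signedSum, Finset.mul_sum]
  exact Finset.sum_congr rfl fun i _ => by ring

theorem signedSum_sum (ε : ι → ℤˣ) (s : Finset κ) (v : κ → ι → ℝ) :
    signedSum ε (fun i => ∑ j ∈ s, v j i) = ∑ j ∈ s, signedSum ε (v j) := by
  simp only [signedSum, Finset.mul_sum]
  exact Finset.sum_comm

theorem abs_sign (u : ℤˣ) : |((u : ℤ) : ℝ)| = 1 := by
  rcases Int.units_eq_one_or u with rfl | rfl <;> simp

theorem abs_signedSum_le (ε : ι → ℤˣ) (v : ι → ℝ) : |signedSum ε v| ≤ ∑ i, |v i| := by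
  refine (Finset.abs_sum_le_sum_abs _ _).trans_eq (Finset.sum_congr rfl fun i _ => ?_)
  rw [abs_mul, abs_sign, one_mul]

/-- The sum over sign vectors factors over the coordinates into factors `2 cosh (v i)`, and `cosh t
≤ exp (t ^ 2 / 2)`. -/
theorem sum_exp_signedSum_le [DecidableEq ι] (v : ι → ℝ) :
    ∑ ε : ι → ℤˣ, Real.exp (signedSum ε v) ≤
      2 ^ Fintype.card ι * Real.exp ((∑ i, v i ^ 2) / 2) := by
  have key : ∑ ε : ι → ℤˣ, Real.exp (signedSum ε v) =
      ∏ i, ∑ u : ℤˣ, Real.exp (((u : ℤ) : ℝ) * v i) := by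
    rw [Finset.prod_univ_sum, Fintype.piFinset_univ]
    exact Finset.sum_congr rfl fun ε _ => by rw [signedSum, Real.exp_sum]
  have h2 : ∀ i, ∑ u : ℤˣ, Real.exp (((u : ℤ) : ℝ) * v i) ≤ 2 * Real.exp (v i ^ 2 / 2) := by
    intro i
    have : ∑ u : ℤˣ, Real.exp (((u : ℤ) : ℝ) * v i) = 2 * Real.cosh (v i) := by
      rw [Real.cosh_eq, show (Finset.univ : Finset ℤˣ) = {1, -1} from rfl,
        Finset.sum_pair (by decide)]
      simp
      ring
    rw [this]
    gcongr
    exact Real.cosh_le_exp_half_sq _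
  rw [key]
  refine (Finset.prod_le_prod (fun i _ => Finset.sum_nonneg fun u _ => (Real.exp_pos _).le)
    fun i _ => h2 i).trans_eq ?_
  rw [Finset.prod_mul_distrib, Finset.prod_const, Finset.card_univ, ← Real.exp_sum,
    Finset.sum_div]

/-- Massart's finite class bound, for a selection of signed sums. -/
theorem sum_le_of_abs_signedSum [DecidableEq ι] {S : Finset κ} {v : κ → ι → ℝ} {r q : ℝ}
    (hr : 0 < r) (hq : 0 < q) (hv : ∀ a ∈ S, ∑ i, v a i ^ 2 ≤ r ^ 2)
    (hS : 2 * (S.card : ℝ) ≤ Real.exp (2 * q ^ 2)) (M : (ι → ℤˣ) → ℝ)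
    (hM : ∀ ε, ∃ a ∈ S, M ε ≤ |signedSum ε (v a)|) :
    ∑ ε, M ε ≤ 2 ^ Fintype.card ι * (2 * q * r) := by
  -- This `t` makes the moment exponent `t ^ 2 * r ^ 2 / 2` equal to the entropy exponent `2 * q ^
  -- 2`; `c` is their sum.
  set t : ℝ := 2 * q / r with ht
  have htpos : 0 < t := by positivity
  set c : ℝ := 4 * q ^ 2 with hc
  have hmgf : ∀ a ∈ S, ∀ s : ℝ, s ^ 2 = 1 →
      ∑ ε : ι → ℤˣ, Real.exp (signedSum ε (fun i => (s * t) * v a i)) ≤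
        2 ^ Fintype.card ι * Real.exp (2 * q ^ 2) := by
    intro a ha s hs
    refine (sum_exp_signedSum_le _).trans ?_
    gcongr
    have : ∑ i, (s * t * v a i) ^ 2 = t ^ 2 * ∑ i, v a i ^ 2 := by
      rw [Finset.mul_sum]
      exact Finset.sum_congr rfl fun i _ => by rw [mul_pow, mul_pow, hs, one_mul]
    rw [this]
    have h1 : t ^ 2 * ∑ i, v a i ^ 2 ≤ t ^ 2 * r ^ 2 := by gcongr; exact hv a ha
    have h2 : t ^ 2 * r ^ 2 = 4 * q ^ 2 := by rw [ht]; field_simp; norm_num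
    linarith
  -- The tangent inequality `y + 1 ≤ exp y` at `y = t * M ε - c` stands in for Jensen: an average of
  -- `exp (t * M)` at most `exp c` gives an average of `t * M` at most `c`.
  have hpt : ∀ ε, t * M ε ≤ c - 1 + Real.exp (-c) *
      ∑ a ∈ S, (Real.exp (signedSum ε (fun i => (1 * t) * v a i)) +
        Real.exp (signedSum ε (fun i => (-1 * t) * v a i))) := by
    intro ε
    obtain ⟨a, ha, hMa⟩ := hM ε
    have h1 := Real.add_one_le_exp (t * M ε - c)
    rw [sub_eq_add_neg, Real.exp_add, mul_comm (Real.exp _)] at h1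
    have h2 : Real.exp (t * M ε) ≤ ∑ a ∈ S,
        (Real.exp (signedSum ε (fun i => (1 * t) * v a i)) +
        Real.exp (signedSum ε (fun i => (-1 * t) * v a i))) := by
      refine le_trans ?_ (Finset.single_le_sum (f := fun a =>
        (Real.exp (signedSum ε (fun i => (1 * t) * v a i)) +
        Real.exp (signedSum ε (fun i => (-1 * t) * v a i))))
        (fun a _ => by positivity) ha)
      simp only [signedSum_mul]
      rcases abs_cases (signedSum ε (v a)) with ⟨h, _⟩ | ⟨h, _⟩
      · have : Real.exp (t * M ε) ≤ Real.exp (1 * t * signedSum ε (v a)) := by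
          rw [one_mul]; gcongr; rwa [← h]
        have := Real.exp_pos (-1 * t * signedSum ε (v a))
        linarith
      · have : Real.exp (t * M ε) ≤ Real.exp (-1 * t * signedSum ε (v a)) := by
          have e : -1 * t * signedSum ε (v a) = t * -signedSum ε (v a) := by ring
          rw [e]; gcongr; rwa [← h]
        have := Real.exp_pos (1 * t * signedSum ε (v a))
        linarith
    have h3 := mul_le_mul_of_nonneg_left h2 (Real.exp_pos (-c)).le
    linarith
  have hsum := Finset.sum_le_sum fun ε (_ : ε ∈ Finset.univ) => hpt ε
  have hcard : (Fintype.card (ι → ℤˣ) : ℝ) = 2 ^ Fintype.card ι := by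
    simp
  rw [← Finset.mul_sum, Finset.sum_add_distrib, ← Finset.mul_sum, Finset.sum_comm,
    Finset.sum_const, Finset.card_univ, nsmul_eq_mul, hcard] at hsum
  have hin : ∑ a ∈ S, ∑ ε : ι → ℤˣ, (Real.exp (signedSum ε (fun i => (1 * t) * v a i)) +
        Real.exp (signedSum ε (fun i => (-1 * t) * v a i))) ≤
      2 ^ Fintype.card ι * Real.exp c := by
    have : ∀ a ∈ S, ∑ ε : ι → ℤˣ, (Real.exp (signedSum ε (fun i => (1 * t) * v a i)) +
        Real.exp (signedSum ε (fun i => (-1 * t) * v a i))) ≤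
        2 * (2 ^ Fintype.card ι * Real.exp (2 * q ^ 2)) := by
      intro a ha
      rw [Finset.sum_add_distrib]
      have h1 := hmgf a ha 1 (by norm_num)
      have h2 := hmgf a ha (-1) (by norm_num)
      linarith
    refine (Finset.sum_le_sum this).trans ?_
    rw [Finset.sum_const, nsmul_eq_mul]
    have e : Real.exp c = Real.exp (2 * q ^ 2) * Real.exp (2 * q ^ 2) := by
      rw [← Real.exp_add, hc]; ring_nf
    rw [e]
    have := mul_le_mul_of_nonneg_right hS
      (show 0 ≤ (2 : ℝ) ^ Fintype.card ι * Real.exp (2 * q ^ 2) by positivity)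
    linarith
  have hfin : t * ∑ ε, M ε ≤ 2 ^ Fintype.card ι * c := by
    have h1 := mul_le_mul_of_nonneg_left hin (Real.exp_pos (-c)).le
    have h2 : Real.exp (-c) * (2 ^ Fintype.card ι * Real.exp c) = 2 ^ Fintype.card ι := by
      rw [mul_left_comm, ← Real.exp_add]; simp
    rw [h2] at h1
    linarith
  have hid : (2 : ℝ) ^ Fintype.card ι * c = t * (2 ^ Fintype.card ι * (2 * q * r)) := by
    rw [ht, hc]; field_simp; ring
  rw [hid] at hfin
  exact le_of_mul_le_mul_left hfin htpos

/-- Replacing one coordinate of the vectors `q a` by a contraction of it does not increase the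
Rademacher average. -/
theorem sum_iSup_signedSum_le_of_coord [DecidableEq ι] [Nonempty κ] (i : ι) (p q : κ → ι → ℝ)
    (hpq : ∀ a j, j ≠ i → p a j = q a j) (hi : ∀ a b, |p a i - p b i| ≤ |q a i - q b i|)
    (hq : ∀ ε : ι → ℤˣ, BddAbove (Set.range fun a => signedSum ε (q a))) :
    ∑ ε : ι → ℤˣ, ⨆ a, signedSum ε (p a) ≤ ∑ ε : ι → ℤˣ, ⨆ a, signedSum ε (q a) := by
  -- Each sign vector is paired with the one that differs only at `i`. In the sum of the two suprema
  -- coordinate `i` enters only through a difference, which `hi` controls.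
  set flip : (ι → ℤˣ) ≃ (ι → ℤˣ) := Equiv.mulRight (Pi.mulSingle i (-1)) with hflip
  have split : ∀ (ε : ι → ℤˣ) (v : ι → ℝ), signedSum ε v =
      ∑ j ∈ Finset.univ.erase i, ((ε j : ℤ) : ℝ) * v j + ((ε i : ℤ) : ℝ) * v i := fun ε v =>
    (Finset.sum_erase_add _ _ (Finset.mem_univ i)).symm
  have splitf : ∀ (ε : ι → ℤˣ) (v : ι → ℝ), signedSum (flip ε) v =
      ∑ j ∈ Finset.univ.erase i, ((ε j : ℤ) : ℝ) * v j - ((ε i : ℤ) : ℝ) * v i := by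
    intro ε v
    rw [split, sub_eq_add_neg]
    congr 1
    · refine Finset.sum_congr rfl fun j hj => ?_
      simp [hflip, Pi.mulSingle_eq_of_ne (Finset.ne_of_mem_erase hj)]
    · simp [hflip]
  have rest : ∀ (ε : ι → ℤˣ) a, ∑ j ∈ Finset.univ.erase i, ((ε j : ℤ) : ℝ) * p a j =
      ∑ j ∈ Finset.univ.erase i, ((ε j : ℤ) : ℝ) * q a j := fun ε a =>
    Finset.sum_congr rfl fun j hj => by rw [hpq a j (Finset.ne_of_mem_erase hj)]
  have hpair : ∀ ε a b, signedSum ε (p a) + signedSum (flip ε) (p b) ≤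
      (⨆ a, signedSum ε (q a)) + ⨆ a, signedSum (flip ε) (q a) := by
    intro ε a b
    have hab := le_ciSup (hq ε) a
    have hbb := le_ciSup (hq ε) b
    have haa' := le_ciSup (hq (flip ε)) a
    have hbb' := le_ciSup (hq (flip ε)) b
    have hle : ((ε i : ℤ) : ℝ) * (p a i - p b i) ≤ |((ε i : ℤ) : ℝ) * (q a i - q b i)| := by
      refine (le_abs_self _).trans ?_
      rw [abs_mul, abs_mul, abs_sign, one_mul, one_mul]
      exact hi a b
    simp only [splitf, split, rest] at *
    rcases abs_cases (((ε i : ℤ) : ℝ) * (q a i - q b i)) with ⟨h, _⟩ | ⟨h, _⟩ <;>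
    rw [h] at hle <;> linarith
  have hstep : ∀ ε, (⨆ a, signedSum ε (p a)) + ⨆ a, signedSum (flip ε) (p a) ≤
      (⨆ a, signedSum ε (q a)) + ⨆ a, signedSum (flip ε) (q a) := by
    intro ε
    rw [← le_sub_iff_add_le]
    refine ciSup_le fun a => ?_
    rw [le_sub_iff_add_le, ← le_sub_iff_add_le']
    refine ciSup_le fun b => ?_
    rw [le_sub_iff_add_le']
    exact hpair ε a b
  have hsum := Finset.sum_le_sum fun ε (_ : ε ∈ Finset.univ) => hstep ε
  rw [Finset.sum_add_distrib, Finset.sum_add_distrib,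
    Equiv.sum_comp flip (fun ε => ⨆ a, signedSum ε (p a)),
    Equiv.sum_comp flip (fun ε => ⨆ a, signedSum ε (q a))] at hsum
  linarith

/-- The contraction principle for Rademacher averages. -/
theorem sum_iSup_signedSum_le_of_contraction [DecidableEq ι] [Nonempty κ] (p q : κ → ι → ℝ)
    (hpq : ∀ a b i, |p a i - p b i| ≤ |q a i - q b i|) {c : ℝ} (hp : ∀ a i, |p a i| ≤ c)
    (hq : ∀ a i, |q a i| ≤ c) :
    ∑ ε : ι → ℤˣ, ⨆ a, signedSum ε (p a) ≤ ∑ ε : ι → ℤˣ, ⨆ a, signedSum ε (q a) := by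
  have key : ∀ s : Finset ι, ∑ ε : ι → ℤˣ, ⨆ a, signedSum ε (p a) ≤
      ∑ ε : ι → ℤˣ, ⨆ a, signedSum ε (fun i => if i ∈ s then q a i else p a i) := by
    intro s
    induction s using Finset.induction_on with
    | empty => simp
    | insert i s his ih =>
      refine ih.trans (sum_iSup_signedSum_le_of_coord i _ _ ?_ ?_ ?_)
      · intro a j hj
        simp [Finset.mem_insert, hj]
      · intro a b
        simpa [his] using hpq a b i
      · intro ε
        refine ⟨∑ _i : ι, c, ?_⟩
        rintro _ ⟨a, rfl⟩
        refine (le_abs_self _).trans ((abs_signedSum_le _ _).trans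
          (Finset.sum_le_sum fun i _ => ?_))
        split_ifs
        · exact hq a i
        · exact hp a i
  simpa using key Finset.univ

end NeuralEstimation

/-! ### Half-spaces: VC dimension and entropy -/

namespace NeuralEstimation

variable {ι κ : Type*} [Fintype ι] [Fintype κ] {d : ℕ}

open Classical in
/-- The subsets that affine half-spaces cut out of the points `x i`. -/
noncomputable def halfSpaceTraces (x : ι → Fin d → ℝ) : Finset (Finset ι) :=
  Finset.univ.filter fun A => ∃ (w : Fin d → ℝ) (b : ℝ), ∀ i, i ∈ A ↔ 0 < (∑ j, w j * x i j) + b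

theorem mem_halfSpaceTraces {x : ι → Fin d → ℝ} {A : Finset ι} :
    A ∈ halfSpaceTraces x ↔
      ∃ (w : Fin d → ℝ) (b : ℝ), ∀ i, i ∈ A ↔ 0 < (∑ j, w j * x i j) + b := by
  simp [halfSpaceTraces]

theorem empty_mem_halfSpaceTraces (x : ι → Fin d → ℝ) : ∅ ∈ halfSpaceTraces x :=
  mem_halfSpaceTraces.2 ⟨0, -1, by simp⟩

theorem univ_mem_halfSpaceTraces (x : ι → Fin d → ℝ) : Finset.univ ∈ halfSpaceTraces x :=
  mem_halfSpaceTraces.2 ⟨0, 1, by simp⟩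

/-- More than `d + 1` points are affinely dependent, so Radon splits them into two parts with
intersecting convex hulls. Shattering would give a half-space containing one part and missing the
other, hence separating the hulls. -/
theorem card_le_of_shatters_halfSpaceTraces [DecidableEq ι] (x : ι → Fin d → ℝ) {s : Finset ι}
    (hs : (halfSpaceTraces x).Shatters s) : s.card ≤ d + 1 := by
  classical
  by_contra! hcard
  have hdep : ¬ AffineIndependent ℝ (fun i : s => x i) := by
    intro hind
    have h1 := hind.card_le_finrank_succ
    have h2 := Submodule.finrank_le (vectorSpan ℝ (Set.range fun i : s => x i))
    rw [Module.finrank_fin_fun] at h2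
    rw [Fintype.card_coe] at h1
    omega
  obtain ⟨I, p, hp, hp'⟩ := Convex.radon_partition hdep
  obtain ⟨A, hA, hAs⟩ := hs (t := s.filter fun i => ∃ h : i ∈ s, (⟨i, h⟩ : s) ∈ I)
    (Finset.filter_subset _ _)
  obtain ⟨w, b, hwb⟩ := mem_halfSpaceTraces.1 hA
  have hmem : ∀ i : s, (i : ι) ∈ A ↔ i ∈ I := by
    intro i
    have := Finset.ext_iff.1 hAs i
    simpa using this
  have hlin : IsLinearMap ℝ fun y : Fin d → ℝ => ∑ j, w j * y j :=
    ⟨fun y z => by simp [mul_add, Finset.sum_add_distrib],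
     fun c y => by simp [Finset.mul_sum, mul_left_comm]⟩
  have h1 : p ∈ {y : Fin d → ℝ | -b < ∑ j, w j * y j} := by
    refine convexHull_min ?_ (convex_halfSpace_gt hlin _) hp
    rintro _ ⟨i, hi, rfl⟩
    have := (hwb i).1 ((hmem i).2 hi)
    simp only [Set.mem_ofPred_eq]
    linarith
  have h2 : p ∈ {y : Fin d → ℝ | ∑ j, w j * y j ≤ -b} := by
    refine convexHull_min ?_ (convex_halfSpace_le hlin _) hp'
    rintro _ ⟨i, hi, rfl⟩
    have := mt (hwb i).2 (mt (hmem i).1 hi)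
    simp only [Set.mem_ofPred_eq]
    linarith
  simp only [Set.mem_ofPred_eq] at h1 h2
  linarith

theorem sum_choose_le_pow (m D : ℕ) : ∑ k ∈ Finset.Iic D, m.choose k ≤ (m + 1) ^ D := by
  rw [add_pow]
  have : Finset.Iic D = Finset.range (D + 1) := by ext; simp
  rw [this]
  refine Finset.sum_le_sum fun k hk => ?_
  rw [one_pow, mul_one]
  exact (Nat.choose_le_pow _ _).trans
    (Nat.le_mul_of_pos_right _ (Nat.choose_pos (Finset.mem_range_succ_iff.1 hk)))

theorem card_halfSpaceTraces_le (x : ι → Fin d → ℝ) :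
    (halfSpaceTraces x).card ≤ (Fintype.card ι + 1) ^ (d + 1) := by
  classical
  have hvc : (halfSpaceTraces x).vcDim ≤ d + 1 :=
    Finset.sup_le fun s hs =>
      card_le_of_shatters_halfSpaceTraces x (Finset.mem_shatterer.1 hs)
  calc (halfSpaceTraces x).card ≤ (halfSpaceTraces x).shatterer.card :=
        Finset.card_le_card_shatterer _
    _ ≤ ∑ k ∈ Finset.Iic (halfSpaceTraces x).vcDim, (Fintype.card ι).choose k :=
        Finset.card_shatterer_le_sum_vcDim
    _ ≤ (Fintype.card ι + 1) ^ (halfSpaceTraces x).vcDim := sum_choose_le_pow _ _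
    _ ≤ _ := Nat.pow_le_pow_right (by omega) hvc

theorem filter_comp_mem_halfSpaceTraces [DecidableEq ι] {x : ι → Fin d → ℝ} {A : Finset ι}
    (hA : A ∈ halfSpaceTraces x) (c : κ → ι) :
    (Finset.univ.filter fun l => c l ∈ A) ∈ halfSpaceTraces (x ∘ c) := by
  obtain ⟨w, b, h⟩ := mem_halfSpaceTraces.1 hA
  exact mem_halfSpaceTraces.2 ⟨w, b, fun l => by simpa using h (c l)⟩

/-- A family of traces is small if random samples of `m` points separate it. -/
theorem card_le_of_separated [DecidableEq ι] {x : ι → Fin d → ℝ} {N : Finset (Finset ι)}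
    (hN : N ⊆ halfSpaceTraces x) {δ : ℝ}
    (hsep : ∀ A ∈ N, ∀ A' ∈ N, A ≠ A' → δ * Fintype.card ι ≤ ((symmDiff A A').card : ℝ))
    {m : ℕ} (hm : (N.card : ℝ) ^ 2 * (1 - δ) ^ m < 1) (hι : 0 < Fintype.card ι) :
    N.card ≤ (m + 1) ^ (d + 1) := by
  set n := Fintype.card ι with hn
  -- A sample `c` of `m` points on which the members of `N` stay distinct embeds `N` into the traces
  -- on `m` points, whose number does not depend on `n`.
  by_cases hex : ∃ c : Fin m → ι, ∀ A ∈ N, ∀ A' ∈ N,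
      (Finset.univ.filter fun l => c l ∈ A) = (Finset.univ.filter fun l => c l ∈ A') → A = A'
  · obtain ⟨c, hc⟩ := hex
    have h1 : N.card ≤ (halfSpaceTraces (x ∘ c)).card :=
      Finset.card_le_card_of_injOn (fun A => Finset.univ.filter fun l => c l ∈ A)
        (fun A hA => filter_comp_mem_halfSpaceTraces (hN hA) c)
        (fun A hA A' hA' h => hc A hA A' hA' h)
    simpa using h1.trans (card_halfSpaceTraces_le _)
  · exfalso
    push Not at hex
    -- Union bound by counting: if no sample works, every sample avoids the symmetric difference of
    -- some pair, and a given pair accounts for at most `((1 - δ) * n) ^ m` samples.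
    have hcover : (Finset.univ : Finset (Fin m → ι)) ⊆
        ((N ×ˢ N).filter fun q => q.1 ≠ q.2).biUnion fun q =>
          Fintype.piFinset fun _ => (symmDiff q.1 q.2)ᶜ := by
      intro c _
      obtain ⟨A, hA, A', hA', h, hne⟩ := hex c
      simp only [Finset.mem_biUnion, Finset.mem_filter, Finset.mem_product,
        Fintype.mem_piFinset, Finset.mem_compl]
      refine ⟨(A, A'), ⟨⟨hA, hA'⟩, hne⟩, fun l => ?_⟩
      have := Finset.ext_iff.1 h l
      simp only [Finset.mem_filter, Finset.mem_univ, true_and] at this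
      simp [Finset.mem_symmDiff, this]
    have hcard := (Finset.card_le_card hcover).trans Finset.card_biUnion_le
    have hterm : ∀ q ∈ (N ×ˢ N).filter fun q => q.1 ≠ q.2,
        ((Fintype.piFinset fun _ : Fin m => (symmDiff q.1 q.2)ᶜ).card : ℝ) ≤
          ((1 - δ) * n) ^ m := by
      intro q hq
      simp only [Finset.mem_filter, Finset.mem_product] at hq
      rw [Fintype.card_piFinset_const, Nat.cast_pow]
      gcongr
      rw [Finset.card_compl, Nat.cast_sub (Finset.card_le_univ _)]
      have := hsep _ hq.1.1 _ hq.1.2 hq.2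
      linarith
    have hcard' : (n : ℝ) ^ m ≤ (N.card : ℝ) ^ 2 * ((1 - δ) * n) ^ m := by
      have h0 : (n : ℝ) ^ m ≤ ∑ q ∈ (N ×ˢ N).filter fun q => q.1 ≠ q.2,
          ((Fintype.piFinset fun _ : Fin m => (symmDiff q.1 q.2)ᶜ).card : ℝ) := by
        have : n ^ m ≤ ∑ q ∈ (N ×ˢ N).filter fun q => q.1 ≠ q.2,
          (Fintype.piFinset fun _ : Fin m => (symmDiff q.1 q.2)ᶜ).card := by
          simpa [Finset.card_univ] using hcard
        exact_mod_cast this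
      refine h0.trans ((Finset.sum_le_sum hterm).trans ?_)
      rw [Finset.sum_const, nsmul_eq_mul]
      by_cases hemp : ((N ×ˢ N).filter fun q => q.1 ≠ q.2) = ∅
      · rw [hemp] at h0
        have : (0 : ℝ) < (n : ℝ) ^ m := by positivity
        simp at h0
        linarith
      · obtain ⟨q, hq⟩ := Finset.nonempty_iff_ne_empty.2 hemp
        have hpos : 0 ≤ ((1 - δ) * n) ^ m := le_trans (by positivity) (hterm q hq)
        refine mul_le_mul_of_nonneg_right ?_ hpos
        have := (Finset.card_filter_le (N ×ˢ N) fun q => q.1 ≠ q.2)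
        rw [Finset.card_product, ← sq] at this
        exact_mod_cast this
    rw [mul_pow, ← mul_assoc] at hcard'
    have hnpos : (0 : ℝ) < (n : ℝ) ^ m := by positivity
    exact absurd hcard' (not_le.2 (mul_lt_of_lt_one_left hnpos hm))

/-- Entropy bound for traces of half-spaces. -/
theorem two_mul_card_le_of_separated [DecidableEq ι] {x : ι → Fin d → ℝ} {N : Finset (Finset ι)}
    (hN : N ⊆ halfSpaceTraces x) {s : ℝ} (hs : 1 ≤ s)
    (hsep : ∀ A ∈ N, ∀ A' ∈ N, A ≠ A' →
      (s ^ 2)⁻¹ * Fintype.card ι ≤ ((symmDiff A A').card : ℝ)) (hι : 0 < Fintype.card ι) :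
    2 * (N.card : ℝ) ≤ Real.exp (8 * (d + 1 : ℝ) ^ 2 * s) := by
  have hs0 : 0 < s := by linarith
  set D : ℝ := d + 1 with hD
  have hD1 : 1 ≤ D := by rw [hD]; have : (0 : ℝ) ≤ d := by positivity
                         linarith
  rcases N.eq_empty_or_nonempty with rfl | hne
  · simp [Real.exp_nonneg]
  have hNpos : (1 : ℝ) ≤ N.card := by exact_mod_cast hne.card_pos
  set L := Real.log N.card with hL
  have hL0 : 0 ≤ L := Real.log_nonneg hNpos
  have hexpL : Real.exp L = N.card := Real.exp_log (by linarith)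
  -- Just large enough that `exp (2 * L - m / s ^ 2) < 1`, as the sampling lemma requires.
  set m := ⌊2 * L * s ^ 2⌋₊ + 1 with hm
  have hmlt : 2 * L * s ^ 2 < m := by
    rw [hm]; push_cast; exact Nat.lt_floor_add_one _
  have hmle : (m : ℝ) ≤ 2 * L * s ^ 2 + 1 := by
    rw [hm]; push_cast; gcongr; exact Nat.floor_le (by positivity)
  have hδ1 : (s ^ 2)⁻¹ ≤ 1 := inv_le_one_of_one_le₀ (one_le_pow₀ hs)
  have hsmall : (N.card : ℝ) ^ 2 * (1 - (s ^ 2)⁻¹) ^ m < 1 := by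
    have h1 : (1 - (s ^ 2)⁻¹) ^ m ≤ Real.exp (-(s ^ 2)⁻¹) ^ m := by
      refine pow_le_pow_left₀ (by linarith) ?_ _
      have := Real.add_one_le_exp (-(s ^ 2)⁻¹)
      linarith
    rw [← Real.exp_nat_mul] at h1
    rw [← hexpL, ← Real.exp_nat_mul]
    calc Real.exp ((2 : ℕ) * L) * (1 - (s ^ 2)⁻¹) ^ m
        ≤ Real.exp ((2 : ℕ) * L) * Real.exp (m * -(s ^ 2)⁻¹) := by gcongr
      _ = Real.exp ((2 : ℕ) * L + m * -(s ^ 2)⁻¹) := (Real.exp_add _ _).symm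
      _ < 1 := by
        rw [Real.exp_lt_one_iff]
        have : 2 * L < m * (s ^ 2)⁻¹ := by
          rw [← div_eq_mul_inv, lt_div_iff₀ (by positivity)]; exact hmlt
        push_cast
        linarith
  have hcard := card_le_of_separated hN hsep hsmall hι
  have hcardR : Real.exp L ≤ (2 * L * s ^ 2 + 2) ^ (d + 1) := by
    rw [hexpL]
    have : (N.card : ℝ) ≤ ((m : ℝ) + 1) ^ (d + 1) := by exact_mod_cast hcard
    exact this.trans (pow_le_pow_left₀ (by positivity) (by linarith) _)
  have hz : Real.exp (L / D) ≤ 2 * L * s ^ 2 + 2 := by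
    have e : Real.exp L = Real.exp (L / D) ^ (d + 1) := by
      rw [← Real.exp_nat_mul]
      congr 1
      push_cast
      rw [← hD]
      field_simp
    rw [e] at hcardR
    exact le_of_pow_le_pow_left₀ (by omega) (by positivity) hcardR
  -- The inequality `hz` bounds `L` by itself. The cubic Taylor term of `exp z`, with `z = L / D`,
  -- already contradicts it when `z > 4 * D * s`; the resulting linear growth in `s` is what lets
  -- the chaining series converge.
  have hLle : L ≤ 4 * D ^ 2 * s := by
    by_contra! hlt
    set z := L / D with hzdef
    have hLz : L = D * z := by rw [hzdef]; field_simp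
    have hz4 : 4 * D * s < z := by
      rw [hzdef, lt_div_iff₀ (by positivity)]; linarith
    have hzpos : 0 < z := lt_trans (by positivity) hz4
    have h3 := Real.pow_div_factorial_le_exp z hzpos.le 3
    have h4 : z ^ 3 / 6 ≤ 2 * (D * z) * s ^ 2 + 2 := by
      rw [← hLz]
      refine le_trans ?_ hz
      simpa [Nat.factorial] using h3
    have h5 : (4 * D * s) ^ 2 ≤ z ^ 2 := by gcongr
    have h6 : (4 * D * s) ^ 2 * z ≤ z ^ 3 := by
      rw [pow_succ z 2]
      exact mul_le_mul_of_nonneg_right h5 hzpos.le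
    have hDs : D * s ^ 2 * z ≤ D ^ 2 * s ^ 2 * z := by
      gcongr
      exact le_self_pow₀ hD1 two_ne_zero
    have h7 : 4 < D * s ^ 2 * z := by
      have a1 : 1 ≤ D * s ^ 2 := one_le_mul_of_one_le_of_one_le hD1 (one_le_pow₀ hs)
      have a2 : 1 ≤ D * s := one_le_mul_of_one_le_of_one_le hD1 hs
      have a3 : 4 < z := by linarith
      exact a3.trans_le (le_mul_of_one_le_left hzpos.le a1)
    have h8 : (4 * D * s) ^ 2 * z = 16 * (D ^ 2 * s ^ 2 * z) := by ring
    have h9 : 2 * (D * z) * s ^ 2 = 2 * (D * s ^ 2 * z) := by ring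
    linarith
  have h2 : (2 : ℝ) ≤ Real.exp 1 := by
    have := Real.add_one_le_exp (1 : ℝ); linarith
  calc 2 * (N.card : ℝ) ≤ Real.exp 1 * Real.exp L := by rw [hexpL]; gcongr
    _ = Real.exp (1 + L) := (Real.exp_add _ _).symm
    _ ≤ _ := by
      gcongr
      have : 1 ≤ D ^ 2 * s := one_le_mul_of_one_le_of_one_le (one_le_pow₀ hD1) hs
      linarith

end NeuralEstimation

/-! ### Chaining over half-spaces and the layer-cake reduction -/

namespace NeuralEstimation

variable {ι : Type*} [Fintype ι] {d : ℕ}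

/-- The indicator vector of a finite set. -/
def indVec [DecidableEq ι] (A : Finset ι) (i : ι) : ℝ := if i ∈ A then 1 else 0

theorem sum_indVec_sub_sq [DecidableEq ι] (A B : Finset ι) :
    ∑ i, (indVec A i - indVec B i) ^ 2 = ((symmDiff A B).card : ℝ) := by
  rw [Finset.card_eq_sum_ones, Nat.cast_sum, ← Finset.sum_subset (Finset.subset_univ _)
    (f := fun i => (indVec A i - indVec B i) ^ 2)]
  · refine Finset.sum_congr rfl fun i hi => ?_
    rcases Finset.mem_symmDiff.1 hi with ⟨h1, h2⟩ | ⟨h1, h2⟩ <;> simp [indVec, h1, h2]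
  · intro i _ hi
    by_cases h1 : i ∈ A <;> by_cases h2 : i ∈ B <;>
      simp_all [indVec, Finset.mem_symmDiff]

/-- A separated family of maximal cardinality is a net: a trace far from all of its members could be
added. -/
theorem exists_net_halfSpaceTraces [DecidableEq ι] (x : ι → Fin d → ℝ) {s : ℝ} (hs : 1 ≤ s)
    (hι : 0 < Fintype.card ι) :
    ∃ N ⊆ halfSpaceTraces x, 2 * (N.card : ℝ) ≤ Real.exp (8 * (d + 1 : ℝ) ^ 2 * s) ∧
      ∀ A ∈ halfSpaceTraces x, ∃ B ∈ N,
        ((symmDiff A B).card : ℝ) ≤ (s ^ 2)⁻¹ * Fintype.card ι := by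
  classical
  let sep : Finset (Finset ι) → Prop := fun N => ∀ A ∈ N, ∀ A' ∈ N, A ≠ A' →
      (s ^ 2)⁻¹ * Fintype.card ι ≤ ((symmDiff A A').card : ℝ)
  obtain ⟨N, hN, hmax⟩ := Finset.exists_max_image
    ((halfSpaceTraces x).powerset.filter sep) Finset.card
    ⟨∅, by simp [sep]⟩
  simp only [Finset.mem_filter, Finset.mem_powerset] at hN hmax
  refine ⟨N, hN.1, two_mul_card_le_of_separated hN.1 hs hN.2 hι, fun A hA => ?_⟩
  by_contra! hfar
  have hAN : A ∉ N := by
    intro h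
    have := hfar A h
    rw [symmDiff_self] at this
    simp only [Finset.bot_eq_empty, Finset.card_empty, Nat.cast_zero] at this
    exact absurd this (not_lt.2 (by positivity))
  have := hmax (insert A N) ⟨Finset.insert_subset hA hN.1, ?_⟩
  · rw [Finset.card_insert_of_notMem hAN] at this
    omega
  · intro B hB B' hB' hne
    rcases Finset.mem_insert.1 hB with rfl | hBN <;>
      rcases Finset.mem_insert.1 hB' with rfl | hBN'
    · exact absurd rfl hne
    · exact (hfar _ hBN').le
    · rw [symmDiff_comm]; exact (hfar _ hBN).le
    · exact hN.2 _ hBN _ hBN' hne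

/-- Chaining bound for the Rademacher averages of half-spaces, for any choice of half-spaces. -/
theorem sum_abs_signedSum_indVec_le [DecidableEq ι] (x : ι → Fin d → ℝ)
    (hι : 0 < Fintype.card ι) (A : (ι → ℤˣ) → Finset ι) (hA : ∀ ε, A ε ∈ halfSpaceTraces x) :
    ∑ ε, |signedSum ε (indVec (A ε))| ≤
      2 ^ Fintype.card ι * (20 * (d + 1) * Real.sqrt (Fintype.card ι)) := by
  set n := Fintype.card ι with hn
  set D : ℝ := d + 1 with hD
  have hD1 : 0 < D := by positivity
  have hsqrt : 0 < Real.sqrt n := Real.sqrt_pos.2 (by exact_mod_cast hι)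
  -- At scale `s = 4 ^ j` the net has `ℓ²` radius `√n / 4 ^ j` and entropy parameter `q = 2 * D * 2
  -- ^ j`, so radius times `q` decays like `2 ^ (-j)`.
  have hnet := fun j : ℕ => exists_net_halfSpaceTraces x (s := (4 : ℝ) ^ j)
    (one_le_pow₀ (by norm_num)) hι
  choose N hNsub hNcard hNcov using hnet
  have hexp : ∀ j : ℕ, 2 * ((N j).card : ℝ) ≤ Real.exp (2 * (2 * D * 2 ^ j) ^ 2) := by
    intro j
    refine (hNcard j).trans_eq ?_
    rw [← hD, show (4 : ℝ) ^ j = (2 ^ j) ^ 2 by rw [← pow_mul, mul_comm, pow_mul]; norm_num]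
    congr 1
    ring
  -- The coarsest net costs `4 * D * √n` and the link from level `j` to `j + 1` costs `8 * (1 / 2) ^
  -- j * D * √n`; the partial sums are the stated factor `20 - 16 * (1 / 2) ^ j`.
  have main : ∀ (j : ℕ) (a : (ι → ℤˣ) → Finset ι), (∀ ε, a ε ∈ N j) →
      ∑ ε, |signedSum ε (indVec (a ε))| ≤
        2 ^ n * ((20 - 16 * (1 / 2) ^ j) * D * Real.sqrt n) := by
    intro j
    induction j with
    | zero =>
      intro a ha
      refine (sum_le_of_abs_signedSum (S := N 0) (v := indVec) (r := Real.sqrt n)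
        (q := 2 * D * 2 ^ 0) hsqrt (by positivity) ?_ (hexp 0) _
        fun ε => ⟨a ε, ha ε, le_rfl⟩).trans_eq ?_
      · intro B _
        have := sum_indVec_sub_sq B ∅
        simp only [indVec, Finset.notMem_empty, if_false, sub_zero] at this
        simp only [indVec]
        rw [this, Real.sq_sqrt (by positivity)]
        exact_mod_cast Finset.card_le_univ _
      · ring
    | succ j ih =>
      intro a ha
      have hp : ∀ B, ∃ B', B ∈ N (j + 1) → B' ∈ N j ∧
          ((symmDiff B B').card : ℝ) ≤ (((4 : ℝ) ^ j) ^ 2)⁻¹ * n := by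
        intro B
        by_cases hB : B ∈ N (j + 1)
        · obtain ⟨B', h1, h2⟩ := hNcov j B (hNsub _ hB)
          exact ⟨B', fun _ => ⟨h1, h2⟩⟩
        · exact ⟨∅, fun h => absurd h hB⟩
      choose p hp using hp
      have h1 := ih (fun ε => p (a ε)) fun ε => (hp _ (ha ε)).1
      have h2 := sum_le_of_abs_signedSum (S := N (j + 1))
        (v := fun B i => indVec B i - indVec (p B) i) (r := ((4 : ℝ) ^ j)⁻¹ * Real.sqrt n)
        (q := 2 * D * 2 ^ (j + 1)) (by positivity) (by positivity) ?_ (hexp (j + 1))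
        (fun ε => |signedSum ε (fun i => indVec (a ε) i - indVec (p (a ε)) i)|)
        fun ε => ⟨a ε, ha ε, le_rfl⟩
      · have h3 : ∀ ε, |signedSum ε (indVec (a ε))| ≤ |signedSum ε (indVec (p (a ε)))| +
            |signedSum ε (fun i => indVec (a ε) i - indVec (p (a ε)) i)| := by
          intro ε
          rw [signedSum_sub]
          have := abs_add_le (signedSum ε (indVec (p (a ε))))
            (signedSum ε (indVec (a ε)) - signedSum ε (indVec (p (a ε))))
          simpa using this
        have h4 := Finset.sum_le_sum fun ε (_ : ε ∈ Finset.univ) => h3 ε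
        rw [Finset.sum_add_distrib] at h4
        refine (h4.trans (add_le_add h1 h2)).trans_eq ?_
        have e : (2 : ℝ) ^ (j + 1) * ((4 : ℝ) ^ j)⁻¹ = 2 * (1 / 2) ^ j := by
          rw [show (4 : ℝ) = 2 * 2 by norm_num, mul_pow, pow_succ, one_div, inv_pow]
          field_simp
        have e2 : 2 * (2 * D * 2 ^ (j + 1)) * (((4 : ℝ) ^ j)⁻¹ * Real.sqrt n) =
            8 * (1 / 2) ^ j * D * Real.sqrt n := by
          linear_combination (4 * D * Real.sqrt n) * e
        rw [e2, pow_succ (1 / 2 : ℝ)]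
        ring
      · intro B hB
        rw [sum_indVec_sub_sq, mul_pow, Real.sq_sqrt (by positivity), inv_pow]
        exact (hp B hB).2
  -- Once `16 ^ j > n` the net radius is below one point, so the net contains every trace and the
  -- chain stops.
  obtain ⟨j, hj⟩ := pow_unbounded_of_one_lt (n : ℝ) (show (1 : ℝ) < 16 by norm_num)
  have hAN : ∀ ε, A ε ∈ N j := by
    intro ε
    obtain ⟨B, hB, hAB⟩ := hNcov j _ (hA ε)
    have hlt : ((symmDiff (A ε) B).card : ℝ) < 1 := by
      refine hAB.trans_lt ?_
      rw [← pow_mul, mul_comm j 2, pow_mul, inv_mul_lt_one₀ (by positivity)]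
      norm_num
      exact hj
    have h0 : (symmDiff (A ε) B).card = 0 := by
      have : (symmDiff (A ε) B).card < 1 := by exact_mod_cast hlt
      omega
    rw [Finset.card_eq_zero] at h0
    have : A ε = B := symmDiff_eq_bot.1 h0
    rwa [this]
  refine (main j A hAN).trans ?_
  gcongr
  have : (0 : ℝ) ≤ (1 / 2) ^ j := by positivity
  linarith

/-- The largest signed sum over a half-space. -/
theorem exists_halfSpace_bound [DecidableEq ι] (x : ι → Fin d → ℝ) (hι : 0 < Fintype.card ι) :
    ∃ H : (ι → ℤˣ) → ℝ, (∀ ε, ∀ A ∈ halfSpaceTraces x, |signedSum ε (indVec A)| ≤ H ε) ∧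
      ∑ ε, H ε ≤ 2 ^ Fintype.card ι * (20 * (d + 1) * Real.sqrt (Fintype.card ι)) := by
  choose A hA hmax using fun ε : ι → ℤˣ => Finset.exists_max_image (halfSpaceTraces x)
    (fun A => |signedSum ε (indVec A)|) ⟨∅, empty_mem_halfSpaceTraces x⟩
  exact ⟨fun ε => |signedSum ε (indVec (A ε))|, hmax, sum_abs_signedSum_indVec_le x hι A hA⟩

/-- Layer cake: `u i` is the integral over `s ∈ [0, M]` of the indicator of `s < u i`, and signed
sums commute with the integral. -/
theorem abs_signedSum_le_of_upperLevelSets [DecidableEq ι] (ε : ι → ℤˣ) (u : ι → ℝ) {M H : ℝ}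
    (hM : 0 ≤ M) (hu : ∀ i, 0 ≤ u i) (huM : ∀ i, u i ≤ M)
    (hH : ∀ s, 0 ≤ s → |signedSum ε (indVec (Finset.univ.filter fun i => s < u i))| ≤ H) :
    |signedSum ε u| ≤ M * H := by
  have hint : ∀ i, IntervalIntegrable (fun s => ((ε i : ℤ) : ℝ) *
      indVec (Finset.univ.filter fun i => s < u i) i) volume 0 M := by
    intro i
    refine IntervalIntegrable.const_mul ?_ _
    refine AntitoneOn.intervalIntegrable ?_
    intro s _ t _ hst
    simp only [indVec, Finset.mem_filter, Finset.mem_univ, true_and]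
    split_ifs with h1 h2
    · norm_num
    · exact absurd (hst.trans_lt h1) h2
    · norm_num
    · norm_num
  have hval : ∀ i, ∫ s in (0 : ℝ)..M, indVec (Finset.univ.filter fun i => s < u i) i = u i := by
    intro i
    have e : (fun s => indVec (Finset.univ.filter fun i => s < u i) i) =
        (Set.Iio (u i)).indicator fun _ => (1 : ℝ) := by
      ext s
      simp [indVec, Set.indicator]
    rw [e, intervalIntegral.integral_of_le hM, integral_Ioc_eq_integral_Ioo,
      setIntegral_indicator measurableSet_Iio]
    have : Set.Ioo 0 M ∩ Set.Iio (u i) = Set.Ioo 0 (u i) := by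
      rw [Set.Ioo_inter_Iio, min_eq_right (huM i)]
    rw [this]
    simp [hu i]
  have heq : signedSum ε u = ∫ s in (0 : ℝ)..M,
      signedSum ε (indVec (Finset.univ.filter fun i => s < u i)) := by
    simp only [signedSum]
    rw [intervalIntegral.integral_finsetSum fun i _ => hint i]
    refine Finset.sum_congr rfl fun i _ => ?_
    rw [intervalIntegral.integral_const_mul, hval]
  rw [heq, ← Real.norm_eq_abs]
  refine (intervalIntegral.norm_integral_le_of_norm_le_const (C := H) fun s hs => ?_).trans_eq ?_
  · rw [Set.uIoc_of_le hM] at hs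
    exact hH s hs.1.le
  · rw [sub_zero, abs_of_nonneg hM, mul_comm]

/-- Signed sums of a monotone function of affine functions are controlled by half-spaces. -/
theorem abs_signedSum_comp_le [DecidableEq ι] {x : ι → Fin d → ℝ} {ε : ι → ℤˣ} {H : ℝ}
    (hH : ∀ A ∈ halfSpaceTraces x, |signedSum ε (indVec A)| ≤ H) {φ : ℝ → ℝ} (hφ : Monotone φ)
    (w : Fin d → ℝ) (b : ℝ) {M : ℝ} (hM : 0 ≤ M)
    (h0 : ∀ i, 0 ≤ φ ((∑ j, w j * x i j) + b)) (h1 : ∀ i, φ ((∑ j, w j * x i j) + b) ≤ M) :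
    |signedSum ε (fun i => φ ((∑ j, w j * x i j) + b))| ≤ M * H := by
  refine abs_signedSum_le_of_upperLevelSets ε _ hM h0 h1 fun s _ => hH _ ?_
  -- An upper level set of the neuron is cut out by thresholding the affine function at its largest
  -- value among the points outside the level set. If there are none, it is the full trace.
  rcases (Finset.univ.filter fun i => φ ((∑ j, w j * x i j) + b) ≤ s).eq_empty_or_nonempty with
    hemp | hne
  · convert univ_mem_halfSpaceTraces x using 1
    ext i
    have := Finset.ext_iff.1 hemp i
    simpa using this
  · obtain ⟨i₀, hi₀, hmax⟩ := Finset.exists_max_image _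
      (fun i => (∑ j, w j * x i j) + b) hne
    simp only [Finset.mem_filter, Finset.mem_univ, true_and] at hi₀ hmax
    refine mem_halfSpaceTraces.2 ⟨w, -∑ j, w j * x i₀ j, fun i => ?_⟩
    simp only [Finset.mem_filter, Finset.mem_univ, true_and]
    constructor
    · intro h
      by_contra! hle
      have := hφ (show (∑ j, w j * x i j) + b ≤ (∑ j, w j * x i₀ j) + b by linarith)
      linarith
    · intro h
      by_contra! hle
      have := hmax i hle
      linarith

end NeuralEstimation

/-! ### Symmetrization -/

namespace NeuralEstimation

/-- Symmetrization: uniform deviations of empirical means are at most twice the worst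
Rademacher average. -/
theorem lintegral_iSup_deviation_le {E κ : Type*} [MeasurableSpace E] [Countable κ]
    (μ : Measure E) [IsProbabilityMeasure μ] {n : ℕ} (f : κ → E → ℝ)
    (hf : ∀ m, Measurable (f m)) {c : ℝ} (hc : ∀ m x, |f m x| ≤ c) (K : ℝ≥0∞)
    (hK : ∀ x : Fin n → E,
      ∑ ε : Fin n → ℤˣ, ⨆ m, ‖signedSum ε (fun i => f m (x i))‖ₑ ≤ 2 ^ n * K) :
    ∫⁻ x, ⨆ m, ‖∑ i, f m (x i) - n * ∫ y, f m y ∂μ‖ₑ ∂(Measure.pi fun _ : Fin n => μ) ≤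
      2 * K := by
  set π : Measure (Fin n → E) := Measure.pi fun _ => μ with hπ
  have hint : ∀ m, Integrable (f m) μ := fun m =>
    Integrable.of_bound (hf m).aestronglyMeasurable c (Filter.Eventually.of_forall (hc m))
  have hev : ∀ i : Fin n, MeasurePreserving (Function.eval i) π μ := fun i =>
    measurePreserving_eval (fun _ => μ) i
  have hinti : ∀ m i, Integrable (fun x' : Fin n → E => f m (x' i)) π := fun m i =>
    (hev i).integrable_comp_of_integrable (hint m)
  -- Ghost sample: the mean is written as the expectation over an independent copy `x'`, and the
  -- supremum then moves inside that integral.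
  have hghost : ∀ (x : Fin n → E) m, ∑ i, f m (x i) - n * ∫ y, f m y ∂μ =
      ∫ x' : Fin n → E, ∑ i, (f m (x i) - f m (x' i)) ∂π := by
    intro x m
    have hsub : ∀ i, Integrable (fun x' : Fin n → E => f m (x i) - f m (x' i)) π := fun i =>
      (integrable_const _).sub (hinti m i)
    rw [integral_finsetSum _ fun i _ => hsub i]
    have : ∀ i, ∫ x' : Fin n → E, (f m (x i) - f m (x' i)) ∂π = f m (x i) - ∫ y, f m y ∂μ := by
      intro i
      rw [integral_sub (integrable_const _) (hinti m i), integral_const, probReal_univ, one_smul]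
      congr 1
      rw [← (hev i).map_eq, integral_map (hev i).measurable.aemeasurable
        (hf m).aestronglyMeasurable]
    simp [this]
  have hstep1 : ∫⁻ x, ⨆ m, ‖∑ i, f m (x i) - n * ∫ y, f m y ∂μ‖ₑ ∂π ≤
      ∫⁻ x, ∫⁻ x', ⨆ m, ‖∑ i, (f m (x i) - f m (x' i))‖ₑ ∂π ∂π := by
    refine lintegral_mono fun x => iSup_le fun m => ?_
    rw [hghost]
    exact (enorm_integral_le_lintegral_enorm _).trans
      (lintegral_mono fun x' => le_iSup (fun m => ‖∑ i, (f m (x i) - f m (x' i))‖ₑ) m)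
  set ρ : Measure (Fin n → E × E) := Measure.pi fun _ => μ.prod μ with hρ
  let g : (Fin n → ℤˣ) → (Fin n → E × E) → ℝ≥0∞ := fun ε z =>
    ⨆ m, ‖signedSum ε (fun i => f m (z i).1 - f m (z i).2)‖ₑ
  have hgmeas : ∀ ε, Measurable (g ε) := by
    intro ε
    refine Measurable.iSup fun m => Measurable.enorm ?_
    refine Finset.measurable_sum _ fun i _ => Measurable.const_mul ?_ _
    have := hf m
    fun_prop
  have hjoin : ∫⁻ x, ∫⁻ x', ⨆ m, ‖∑ i, (f m (x i) - f m (x' i))‖ₑ ∂π ∂π = ∫⁻ z, g 1 z ∂ρ := by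
    have hmp := measurePreserving_arrowProdEquivProdArrow E E (Fin n) (fun _ => μ) (fun _ => μ)
    have hm : Measurable fun q : (Fin n → E) × (Fin n → E) =>
        ⨆ m, ‖∑ i, (f m (q.1 i) - f m (q.2 i))‖ₑ := by
      refine Measurable.iSup fun m => Measurable.enorm ?_
      refine Finset.measurable_sum _ fun i _ => ?_
      have := hf m
      fun_prop
    rw [← lintegral_prod _ hm.aemeasurable, ← hmp.map_eq, lintegral_map hm hmp.measurable]
    simp [g, signedSum, MeasurableEquiv.arrowProdEquivProdArrow, Equiv.arrowProdEquivProdArrow, hρ]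
  -- Swapping the two members of the pairs with `ε i = -1` preserves the product law, so all sign
  -- vectors give the same integral and may be averaged.
  have hswap : ∀ ε, ∫⁻ z, g ε z ∂ρ = ∫⁻ z, g 1 z ∂ρ := by
    intro ε
    have hmp : MeasurePreserving (fun (z : Fin n → E × E) i =>
        (if ε i = 1 then id else Prod.swap : E × E → E × E) (z i)) ρ ρ := by
      refine measurePreserving_pi (fun _ => μ.prod μ) (fun _ => μ.prod μ) fun i => ?_
      split_ifs
      · exact MeasurePreserving.id _
      · exact Measure.measurePreserving_swap
    rw [← hmp.map_eq, lintegral_map (hgmeas 1) hmp.measurable, hmp.map_eq]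
    refine lintegral_congr fun z => ?_
    refine iSup_congr fun m => ?_
    congr 1
    refine Finset.sum_congr rfl fun i _ => ?_
    rcases Int.units_eq_one_or (ε i) with h | h <;> simp [h]
  have hgle : ∀ z, ∑ ε, g ε z ≤ 2 ^ n * (2 * K) := by
    intro z
    have : ∀ ε, g ε z ≤ (⨆ m, ‖signedSum ε (fun i => f m (z i).1)‖ₑ) +
        ⨆ m, ‖signedSum ε (fun i => f m (z i).2)‖ₑ := by
      intro ε
      refine iSup_le fun m => ?_
      rw [signedSum_sub]
      exact enorm_sub_le.trans (add_le_add
        (le_iSup (fun m => ‖signedSum ε (fun i => f m (z i).1)‖ₑ) m)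
        (le_iSup (fun m => ‖signedSum ε (fun i => f m (z i).2)‖ₑ) m))
    refine (Finset.sum_le_sum fun ε _ => this ε).trans ?_
    rw [Finset.sum_add_distrib]
    refine (add_le_add (hK fun i => (z i).1) (hK fun i => (z i).2)).trans_eq ?_
    ring
  rw [hjoin] at hstep1
  refine hstep1.trans ?_
  have havg : 2 ^ n * ∫⁻ z, g 1 z ∂ρ ≤ 2 ^ n * (2 * K) := by
    calc 2 ^ n * ∫⁻ z, g 1 z ∂ρ = ∑ ε : Fin n → ℤˣ, ∫⁻ z, g ε z ∂ρ := by
          simp [hswap]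
      _ = ∫⁻ z, ∑ ε, g ε z ∂ρ := (lintegral_finsetSum _ fun ε _ => hgmeas ε).symm
      _ ≤ ∫⁻ _, 2 ^ n * (2 * K) ∂ρ := lintegral_mono hgle
      _ = 2 ^ n * (2 * K) := by simp
  exact (ENNReal.mul_le_mul_iff_right (by simp) (by simp)).1 havg

end NeuralEstimation

/-! ### From Rademacher averages to the error of the estimator -/

namespace NeuralEstimation

/-- Uniform deviation bound for a Lipschitz function of a class that contains the zero function. -/
theorem lintegral_iSup_deviation_comp_le {E κ : Type*} [MeasurableSpace E] [Countable κ]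
    (μ : Measure E) [IsProbabilityMeasure μ] {n : ℕ} {f : κ → E → ℝ}
    (hf : ∀ m, Measurable (f m)) {c : ℝ} (hc : ∀ m x, |f m x| ≤ c) {m₀ : κ}
    (hm₀ : ∀ x, f m₀ x = 0) {ψ : ℝ → ℝ} {L : ℝ≥0} (hψ : LipschitzWith L ψ) {K : ℝ}
    (hK : ∀ x : Fin n → E,
      ∑ ε : Fin n → ℤˣ, ⨆ m, signedSum ε (fun i => f m (x i)) ≤ 2 ^ n * K) :
    ∫⁻ x, ⨆ m, ‖∑ i, ψ (f m (x i)) - n * ∫ y, ψ (f m y) ∂μ‖ₑ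
      ∂(Measure.pi fun _ : Fin n => μ) ≤ ENNReal.ofReal (4 * L * K) := by
  have : Nonempty κ := ⟨m₀⟩
  have hlip : ∀ s t, |ψ s - ψ t| ≤ L * |s - t| := fun s t => by
    simpa [Real.dist_eq] using hψ.dist_le_mul s t
  have hfψ : ∀ m, Measurable fun x => ψ (f m x) := fun m => hψ.continuous.measurable.comp (hf m)
  have hcψ : ∀ m x, |ψ (f m x) - ψ 0| ≤ L * c := fun m x => (hlip _ _).trans (by
    rw [sub_zero]
    exact mul_le_mul_of_nonneg_left (hc m x) L.coe_nonneg)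
  have hcLf : ∀ m x, |L * f m x| ≤ L * c := fun m x => by
    rw [abs_mul, NNReal.abs_eq]
    exact mul_le_mul_of_nonneg_left (hc m x) L.coe_nonneg
  have hint : ∀ m, ∫ y, (ψ (f m y) - ψ 0) ∂μ = ∫ y, ψ (f m y) ∂μ - ψ 0 := by
    intro m
    have hi : Integrable (fun y => ψ (f m y) - ψ 0) μ :=
      Integrable.of_bound ((hfψ m).sub_const _).aestronglyMeasurable _
        (Filter.Eventually.of_forall (hcψ m))
    have hi' : Integrable (fun y => ψ (f m y)) μ := 
      (hi.add (integrable_const (ψ 0))).congr (Filter.Eventually.of_forall fun y => by simp)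
    rw [integral_sub hi' (integrable_const _)]
    simp
  have hdev : ∀ (x : Fin n → E) m, ∑ i, ψ (f m (x i)) - n * ∫ y, ψ (f m y) ∂μ =
      ∑ i, (ψ (f m (x i)) - ψ 0) - n * ∫ y, (ψ (f m y) - ψ 0) ∂μ := by
    intro x m
    rw [hint, Finset.sum_sub_distrib]
    simp
    ring
  simp only [hdev]
  refine (lintegral_iSup_deviation_le μ (fun m x => ψ (f m x) - ψ 0)
    (fun m => (hfψ m).sub_const _) hcψ (ENNReal.ofReal (2 * L * K)) fun x => ?_).trans_eq ?_
  · set S : (Fin n → ℤˣ) → ℝ := fun ε => ⨆ m, signedSum ε (fun i => ψ (f m (x i)) - ψ 0) with hS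
    have hbdd : ∀ ε : Fin n → ℤˣ,
        BddAbove (Set.range fun m => signedSum ε (fun i => ψ (f m (x i)) - ψ 0)) := by
      intro ε
      refine ⟨∑ _i : Fin n, L * c, ?_⟩
      rintro _ ⟨m, rfl⟩
      exact (le_abs_self _).trans ((abs_signedSum_le _ _).trans
        (Finset.sum_le_sum fun i _ => hcψ m (x i)))
    -- After `ψ 0` is subtracted, the zero function makes every one-sided supremum nonnegative. The
    -- two-sided supremum is then at most `S ε + S (-ε)`, whose average costs a factor 2;
    -- symmetrization supplies the other factor 2 in `4 * L * K`.
    have hS0 : ∀ ε, 0 ≤ S ε := by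
      intro ε
      refine le_trans ?_ (le_ciSup (hbdd ε) m₀)
      simp [hm₀, signedSum]
    have hpt : ∀ ε, ⨆ m, ‖signedSum ε (fun i => ψ (f m (x i)) - ψ 0)‖ₑ ≤
        ENNReal.ofReal (S ε + S (-ε)) := by
      intro ε
      refine iSup_le fun m => ?_
      rw [← ofReal_norm, Real.norm_eq_abs]
      refine ENNReal.ofReal_le_ofReal (abs_le.2 ⟨?_, ?_⟩)
      · have h1 := le_ciSup (hbdd (-ε)) m
        simp only [signedSum_neg_left] at h1
        have h2 := hS0 ε
        have h3 : -signedSum ε (fun i => ψ (f m (x i)) - ψ 0) ≤ S (-ε) := by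
          simpa only [hS, signedSum_neg_left] using h1
        linarith
      · have h1 : signedSum ε (fun i => ψ (f m (x i)) - ψ 0) ≤ S ε := le_ciSup (hbdd ε) m
        have h2 := hS0 (-ε)
        linarith
    have hcontr : ∑ ε, S ε ≤ 2 ^ n * (L * K) := by
      calc ∑ ε, S ε ≤ ∑ ε : Fin n → ℤˣ, ⨆ m, signedSum ε (fun i => L * f m (x i)) := by
            refine sum_iSup_signedSum_le_of_contraction _ _ (fun a b i => ?_)
              (fun a i => hcψ a (x i)) (fun a i => hcLf a (x i))
            rw [sub_sub_sub_cancel_right, ← mul_sub, abs_mul, NNReal.abs_eq]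
            exact hlip _ _
        _ = L * ∑ ε : Fin n → ℤˣ, ⨆ m, signedSum ε (fun i => f m (x i)) := by
            rw [Finset.mul_sum]
            refine Finset.sum_congr rfl fun ε _ => ?_
            rw [Real.mul_iSup_of_nonneg L.coe_nonneg]
            exact iSup_congr fun m => signedSum_mul _ _ _
        _ ≤ L * (2 ^ n * K) := mul_le_mul_of_nonneg_left (hK x) L.coe_nonneg
        _ = 2 ^ n * (L * K) := by ring
    calc ∑ ε : Fin n → ℤˣ, ⨆ m, ‖signedSum ε (fun i => ψ (f m (x i)) - ψ 0)‖ₑ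
        ≤ ∑ ε, ENNReal.ofReal (S ε + S (-ε)) := Finset.sum_le_sum fun ε _ => hpt ε
      _ = ENNReal.ofReal (∑ ε, (S ε + S (-ε))) :=
          (ENNReal.ofReal_sum_of_nonneg fun ε _ => add_nonneg (hS0 _) (hS0 _)).symm
      _ ≤ ENNReal.ofReal (2 ^ n * (2 * L * K)) := by
          refine ENNReal.ofReal_le_ofReal ?_
          have hneg : ∑ ε, S (-ε) = ∑ ε, S ε := Equiv.sum_comp (Equiv.neg (Fin n → ℤˣ)) S
          rw [Finset.sum_add_distrib, hneg]
          linarith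
      _ = 2 ^ n * ENNReal.ofReal (2 * L * K) := by
          rw [ENNReal.ofReal_mul (by positivity), ENNReal.ofReal_pow (by positivity)]
          simp
  · rw [show (2 : ℝ≥0∞) = ENNReal.ofReal 2 by simp, ← ENNReal.ofReal_mul (by norm_num)]
    congr 1
    ring

theorem enorm_ciSup_sub_ciSup_le {κ : Type*} [Nonempty κ] {f g : κ → ℝ}
    (hf : BddAbove (Set.range f)) (hg : BddAbove (Set.range g)) :
    ‖(⨆ m, f m) - ⨆ m, g m‖ₑ ≤ ⨆ m, ‖f m - g m‖ₑ := by
  by_cases htop : ⨆ m, ‖f m - g m‖ₑ = ⊤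
  · rw [htop]; exact le_top
  set s := (⨆ m, ‖f m - g m‖ₑ).toReal with hs
  have hle : ∀ m, |f m - g m| ≤ s := by
    intro m
    have h1 := ENNReal.toReal_mono htop (le_iSup (fun m => ‖f m - g m‖ₑ) m)
    simpa using h1
  rw [← ENNReal.ofReal_toReal htop, ← hs, ← ofReal_norm, Real.norm_eq_abs]
  refine ENNReal.ofReal_le_ofReal (abs_sub_le_iff.2 ⟨?_, ?_⟩)
  · rw [sub_le_iff_le_add]
    refine ciSup_le fun m => ?_
    have h1 := (abs_le.1 (hle m)).2
    have h2 := le_ciSup hg m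
    linarith
  · rw [sub_le_iff_le_add]
    refine ciSup_le fun m => ?_
    have h1 := (abs_le.1 (hle m)).1
    have h2 := le_ciSup hf m
    linarith

/-- Measurability and mean error of a variational estimator, for a class depending continuously on
a parameter. -/
theorem aemeasurable_and_lintegral_enorm_sub_le {E Θ Ω : Type*} [MeasurableSpace E]
    [TopologicalSpace Θ] [SecondCountableTopology Θ] [MeasurableSpace Ω] {f : Θ → E → ℝ}
    (hf : ∀ θ, Measurable (f θ)) (hcont : ∀ x, Continuous fun θ => f θ x)
    {c : ℝ} (hc : ∀ θ x, |f θ x| ≤ c) {θ₀ : Θ} (hθ₀ : ∀ x, f θ₀ x = 0)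
    {ψ : ℝ → ℝ} {L : ℝ≥0} (hψ : LipschitzWith L ψ) {n : ℕ} (hn : 1 ≤ n) {K : ℝ} (hK0 : 0 ≤ K)
    (hK : ∀ x : Fin n → E, ∀ s : Set Θ, s.Nonempty →
      ∑ ε : Fin n → ℤˣ, ⨆ θ : s, signedSum ε (fun i => f θ (x i)) ≤ 2 ^ n * K)
    (μ ν : Measure E) [IsProbabilityMeasure μ] [IsProbabilityMeasure ν]
    (P : Measure Ω) {X Y : Fin n → Ω → E}
    (hX : HasLaw (fun ω i => X i ω) (Measure.pi fun _ => μ) P)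
    (hY : HasLaw (fun ω i => Y i ω) (Measure.pi fun _ => ν) P) :
    AEMeasurable (fun ω => ⨆ θ, (n : ℝ)⁻¹ * ∑ i, (f θ (X i ω) - ψ (f θ (Y i ω)))) P ∧
    ∫⁻ ω, ‖(⨆ θ, (n : ℝ)⁻¹ * ∑ i, (f θ (X i ω) - ψ (f θ (Y i ω)))) -
        ⨆ θ, (∫ x, f θ x ∂μ - ∫ y, ψ (f θ y) ∂ν)‖ₑ ∂P ≤
      ENNReal.ofReal ((n : ℝ)⁻¹ * (4 * (1 + L) * K)) := by
  -- Continuity in the parameter reduces both suprema to a countable dense set, which gives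
  -- measurability. The point `θ₀` is added because the deviation bound needs the zero function.
  obtain ⟨s₁, hs₁c, hs₁⟩ := TopologicalSpace.exists_countable_dense Θ
  set s := insert θ₀ s₁ with hs
  have hsd : Dense s := hs₁.mono (Set.subset_insert _ _)
  have hsc : Countable s := (hs₁c.insert θ₀).to_subtype
  have hsne : Nonempty s := ⟨⟨θ₀, Set.mem_insert _ _⟩⟩
  have hψf : ∀ θ, Measurable fun y => ψ (f θ y) := fun θ =>
    hψ.continuous.measurable.comp (hf θ)
  have hcψ : ∀ θ x, |ψ (f θ x)| ≤ |ψ 0| + L * c := by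
    intro θ x
    have h1 : |ψ (f θ x) - ψ 0| ≤ L * |f θ x - 0| := by
      simpa [Real.dist_eq] using hψ.dist_le_mul (f θ x) 0
    rw [sub_zero] at h1
    have h2 := mul_le_mul_of_nonneg_left (hc θ x) L.coe_nonneg
    have h3 := abs_add_le (ψ (f θ x) - ψ 0) (ψ 0)
    rw [sub_add_cancel] at h3
    linarith
  have hestc : ∀ x y : Fin n → E,
      Continuous fun θ => (n : ℝ)⁻¹ * ∑ i, (f θ (x i) - ψ (f θ (y i))) := fun x y =>
    continuous_const.mul (continuous_finsetSum _ fun i _ =>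
      (hcont _).sub (hψ.continuous.comp (hcont _)))
  have hdivc : Continuous fun θ => ∫ x, f θ x ∂μ - ∫ y, ψ (f θ y) ∂ν := by
    refine Continuous.sub ?_ ?_
    · exact continuous_of_dominated (bound := fun _ => c) (fun θ => (hf θ).aestronglyMeasurable)
        (fun θ => Filter.Eventually.of_forall (hc θ)) (integrable_const _)
        (Filter.Eventually.of_forall hcont)
    · exact continuous_of_dominated (bound := fun _ => |ψ 0| + L * c)
        (fun θ => (hψf θ).aestronglyMeasurable)
        (fun θ => Filter.Eventually.of_forall (hcψ θ)) (integrable_const _)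
        (Filter.Eventually.of_forall fun x => hψ.continuous.comp (hcont x))
  have hest : ∀ ω, ⨆ θ, (n : ℝ)⁻¹ * ∑ i, (f θ (X i ω) - ψ (f θ (Y i ω))) =
      ⨆ θ : s, (n : ℝ)⁻¹ * ∑ i, (f θ (X i ω) - ψ (f θ (Y i ω))) := fun ω =>
    (hsd.ciSup' (hestc (fun i => X i ω) fun i => Y i ω)).symm
  have hdiv := hsd.ciSup' hdivc
  have hXm : ∀ i, AEMeasurable (X i) P := fun i =>
    (measurable_pi_apply i).comp_aemeasurable hX.aemeasurable
  have hYm : ∀ i, AEMeasurable (Y i) P := fun i =>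
    (measurable_pi_apply i).comp_aemeasurable hY.aemeasurable
  have hnpos : (0 : ℝ) < n := by exact_mod_cast hn
  refine ⟨?_, ?_⟩
  · simp only [hest]
    refine AEMeasurable.iSup fun θ => AEMeasurable.const_mul ?_ _
    refine Finset.aemeasurable_fun_sum _ fun i _ => ?_
    exact ((hf θ).comp_aemeasurable (hXm i)).sub ((hψf θ).comp_aemeasurable (hYm i))
  · set U : (Fin n → E) → ℝ≥0∞ := fun x => ⨆ θ : s, ‖∑ i, f θ (x i) - n * ∫ y, f θ y ∂μ‖ₑ
      with hU
    set V : (Fin n → E) → ℝ≥0∞ :=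
      fun x => ⨆ θ : s, ‖∑ i, ψ (f θ (x i)) - n * ∫ y, ψ (f θ y) ∂ν‖ₑ with hV
    have hUm : Measurable U := by
      refine Measurable.iSup fun θ => Measurable.enorm (Measurable.sub_const ?_ _)
      exact Finset.measurable_fun_sum _ fun i _ => (hf θ).comp (measurable_pi_apply i)
    have hVm : Measurable V := by
      refine Measurable.iSup fun θ => Measurable.enorm (Measurable.sub_const ?_ _)
      exact Finset.measurable_fun_sum _ fun i _ => (hψf θ).comp (measurable_pi_apply i)
    have hUle : ∫⁻ x, U x ∂(Measure.pi fun _ => μ) ≤ ENNReal.ofReal (4 * (1 : ℝ≥0) * K) :=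
      lintegral_iSup_deviation_comp_le μ (f := fun θ : s => f θ) (fun θ => hf θ)
        (fun θ => hc θ) (m₀ := ⟨θ₀, Set.mem_insert _ _⟩) hθ₀ (ψ := id) LipschitzWith.id
        (fun x => hK x s (Set.nonempty_coe_sort.1 hsne))
    have hVle : ∫⁻ x, V x ∂(Measure.pi fun _ => ν) ≤ ENNReal.ofReal (4 * L * K) :=
      lintegral_iSup_deviation_comp_le ν (f := fun θ : s => f θ) (fun θ => hf θ)
        (fun θ => hc θ) (m₀ := ⟨θ₀, Set.mem_insert _ _⟩) hθ₀ hψ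
        (fun x => hK x s (Set.nonempty_coe_sort.1 hsne))
    have hpt : ∀ ω, ‖(⨆ θ, (n : ℝ)⁻¹ * ∑ i, (f θ (X i ω) - ψ (f θ (Y i ω)))) -
        ⨆ θ, (∫ x, f θ x ∂μ - ∫ y, ψ (f θ y) ∂ν)‖ₑ ≤
        ENNReal.ofReal (n : ℝ)⁻¹ * (U (fun i => X i ω) + V fun i => Y i ω) := by
      intro ω
      rw [hest, ← hdiv]
      refine (enorm_ciSup_sub_ciSup_le ?_ ?_).trans (iSup_le fun θ => ?_)
      · refine ⟨(n : ℝ)⁻¹ * ∑ _i : Fin n, (c + (|ψ 0| + L * c)), ?_⟩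
        rintro _ ⟨θ, rfl⟩
        dsimp only
        gcongr with i
        have h1 := (abs_le.1 (hc θ (X i ω))).2
        have h2 := (abs_le.1 (hcψ θ (Y i ω))).1
        linarith
      · refine ⟨c + (|ψ 0| + L * c), ?_⟩
        rintro _ ⟨θ, rfl⟩
        dsimp only
        have h1 : ‖∫ x, f θ x ∂μ‖ ≤ c := by
          simpa using norm_integral_le_of_norm_le_const (μ := μ) (f := f θ)
            (Filter.Eventually.of_forall (hc θ))
        have h2 : ‖∫ x, ψ (f θ x) ∂ν‖ ≤ |ψ 0| + L * c := by
          simpa using norm_integral_le_of_norm_le_const (μ := ν) (f := fun x => ψ (f θ x))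
            (Filter.Eventually.of_forall (hcψ θ))
        have h1' := (abs_le.1 h1).2
        have h2' := (abs_le.1 h2).1
        linarith
      · have e : (n : ℝ)⁻¹ * ∑ i, (f θ (X i ω) - ψ (f θ (Y i ω))) -
            (∫ x, f θ x ∂μ - ∫ y, ψ (f θ y) ∂ν) =
            (n : ℝ)⁻¹ * ((∑ i, f θ (X i ω) - n * ∫ x, f θ x ∂μ) -
              (∑ i, ψ (f θ (Y i ω)) - n * ∫ y, ψ (f θ y) ∂ν)) := by
          rw [Finset.sum_sub_distrib]
          field_simp
          ring
        rw [e, enorm_mul, Real.enorm_of_nonneg (inv_nonneg.2 hnpos.le)]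
        gcongr
        exact enorm_sub_le.trans (add_le_add
          (le_iSup (fun θ : s => ‖∑ i, f θ (X i ω) - n * ∫ y, f θ y ∂μ‖ₑ) θ)
          (le_iSup (fun θ : s => ‖∑ i, ψ (f θ (Y i ω)) - n * ∫ y, ψ (f θ y) ∂ν‖ₑ) θ))
    have hUX : ∫⁻ ω, U (fun i => X i ω) ∂P = ∫⁻ x, U x ∂(Measure.pi fun _ => μ) :=
      hX.lintegral_comp hUm.aemeasurable
    have hVY : ∫⁻ ω, V (fun i => Y i ω) ∂P = ∫⁻ y, V y ∂(Measure.pi fun _ => ν) :=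
      hY.lintegral_comp hVm.aemeasurable
    have hUXm : AEMeasurable (fun ω => U fun i => X i ω) P :=
      hUm.comp_aemeasurable hX.aemeasurable
    refine (lintegral_mono hpt).trans ?_
    rw [lintegral_const_mul' _ _ ENNReal.ofReal_ne_top, lintegral_add_left' hUXm, hUX, hVY,
      ENNReal.ofReal_mul (inv_nonneg.2 hnpos.le)]
    gcongr
    refine (add_le_add hUle hVle).trans_eq ?_
    rw [← ENNReal.ofReal_add (by positivity) (by positivity)]
    congr 1
    push_cast
    ring

end NeuralEstimation

/-! ### Shallow networks: parameters, value sets, Rademacher bound -/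

namespace NeuralEstimation

variable {d k : ℕ}

/-- Parameters `(β, w, b, w₀, b₀)` of a shallow network. -/
abbrev NetParam (d k : ℕ) : Type :=
  (Fin k → ℝ) × (Fin k → Fin d → ℝ) × (Fin k → ℝ) × (Fin d → ℝ) × ℝ

/-- The shallow network with given parameters. -/
def netFun (φ : ℝ → ℝ) (θ : NetParam d k) (x : Fin d → ℝ) : ℝ :=
  ∑ i, θ.1 i * φ ((∑ j, θ.2.1 i j * x j) + θ.2.2.1 i) + (∑ j, θ.2.2.2.1 j * x j) + θ.2.2.2.2

/-- The admissible parameters of a class of shallow networks. -/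
def netParams (d k : ℕ) (a₁ a₂ a₃ a₄ : ℝ) : Set (NetParam d k) :=
  {θ | (∀ i, max (∑ j, |θ.2.1 i j|) |θ.2.2.1 i| ≤ a₁) ∧ (∀ i, |θ.1 i| ≤ a₂) ∧
    |θ.2.2.2.2| ≤ a₃ ∧ ∑ j, |θ.2.2.2.1 j| ≤ a₄}

theorem nnClass_eq_image (a₁ a₂ a₃ a₄ : ℝ) (φ : ℝ → ℝ) :
    nnClass d k a₁ a₂ a₃ a₄ φ = netFun φ '' netParams d k a₁ a₂ a₃ a₄ := by
  ext g
  constructor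
  · rintro ⟨β, w, b, w₀, b₀, h1, h2, h3, h4, hg⟩
    exact ⟨(β, w, b, w₀, b₀), ⟨h1, h2, h3, h4⟩, funext fun x => (hg x).symm⟩
  · rintro ⟨θ, ⟨h1, h2, h3, h4⟩, rfl⟩
    exact ⟨θ.1, θ.2.1, θ.2.2.1, θ.2.2.2.1, θ.2.2.2.2, h1, h2, h3, h4, fun x => rfl⟩

theorem continuous_netFun_param {φ : ℝ → ℝ} (hφ : Continuous φ) (x : Fin d → ℝ) :
    Continuous fun θ : NetParam d k => netFun φ θ x := by
  unfold netFun
  fun_prop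

theorem continuous_netFun {φ : ℝ → ℝ} (hφ : Continuous φ) (θ : NetParam d k) :
    Continuous (netFun φ θ) := by
  unfold netFun
  fun_prop

/-- Since linear functions belong to the class, the bound on its values also bounds `w₀ ⬝ x` on `𝒳`.
-/
theorem linear_mem_nnClass {a₁ a₂ a₃ a₄ : ℝ} (h₁ : 0 ≤ a₁) (h₂ : 0 ≤ a₂) (h₃ : 0 ≤ a₃)
    (φ : ℝ → ℝ) {w₀ : Fin d → ℝ} (hw : ∑ j, |w₀ j| ≤ a₄) :
    (fun x => ∑ j, w₀ j * x j) ∈ nnClass d k a₁ a₂ a₃ a₄ φ :=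
  ⟨0, 0, 0, w₀, 0, by simp [h₁], by simp [h₂], by simpa, hw, by simp⟩

theorem smul_mem_nnClass {a₁ a₂ a₃ a₄ : ℝ} {φ : ℝ → ℝ} {g : (Fin d → ℝ) → ℝ}
    (hg : g ∈ nnClass d k a₁ a₂ a₃ a₄ φ) {c : ℝ} (hc0 : 0 ≤ c) (hc1 : c ≤ 1) :
    (fun x => c * g x) ∈ nnClass d k a₁ a₂ a₃ a₄ φ := by
  obtain ⟨β, w, b, w₀, b₀, h1, h2, h3, h4, hg⟩ := hg
  refine ⟨fun i => c * β i, w, b, fun j => c * w₀ j, c * b₀, h1, fun i => ?_, ?_, ?_, fun x => ?_⟩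
  · rw [abs_mul, abs_of_nonneg hc0]
    exact (mul_le_of_le_one_left (abs_nonneg _) hc1).trans (h2 i)
  · rw [abs_mul, abs_of_nonneg hc0]
    exact (mul_le_of_le_one_left (abs_nonneg _) hc1).trans h3
  · refine le_trans (Finset.sum_le_sum fun j _ => ?_) h4
    rw [abs_mul, abs_of_nonneg hc0]
    exact mul_le_of_le_one_left (abs_nonneg _) hc1
  · simp only [hg]
    simp only [mul_add, Finset.mul_sum, mul_assoc]

/-- A subset of the line that is star-shaped about `0` is an interval. -/
theorem convex_of_mul_mem {V : Set ℝ} (hV : ∀ t ∈ V, ∀ c, 0 ≤ c → c ≤ 1 → c * t ∈ V) :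
    Convex ℝ V := by
  refine Set.OrdConnected.convex ⟨fun x hx y hy z hz => ?_⟩
  rcases le_or_gt 0 z with h0 | h0
  · rcases h0.eq_or_lt with rfl | h0
    · simpa using hV x hx 0 le_rfl zero_le_one
    · have hy0 : 0 < y := h0.trans_le hz.2
      have := hV y hy (z / y) (by positivity) ((div_le_one hy0).2 hz.2)
      rwa [div_mul_cancel₀ _ hy0.ne'] at this
  · have hx0 : x < 0 := hz.1.trans_lt h0
    have := hV x hx (z / x) (div_nonneg_of_nonpos h0.le hx0.le)
      ((div_le_one_of_neg hx0).2 hz.1)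
    rwa [div_mul_cancel₀ _ hx0.ne] at this

/-- On a class closed under contractions, `h` agrees with a globally Lipschitz function. -/
theorem exists_lipschitzWith_eq {E : Type*} {F : Set (E → ℝ)} {𝒳 : Set E}
    (hF : ∀ g ∈ F, ∀ c : ℝ, 0 ≤ c → c ≤ 1 → (fun x => c * g x) ∈ F) {h : ℝ → EReal} {h' : ℝ → ℝ}
    (hh : HasDerivOn h h' (valueInterval F 𝒳)) {B : ℝ≥0}
    (hB : ∀ g ∈ F, ∀ x ∈ 𝒳, ‖h' (g x)‖₊ ≤ B) :
    ∃ ψ : ℝ → ℝ, LipschitzWith B ψ ∧ ∀ g ∈ F, ∀ x ∈ 𝒳, h (g x) = (ψ (g x) : EReal) := by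
  -- The mean value inequality is applied on the attained values only: `h'` is controlled there, and
  -- not necessarily at the end points of `valueInterval F 𝒳`.
  set V : Set ℝ := {t | ∃ g ∈ F, ∃ x ∈ 𝒳, g x = t} with hV
  have hVI : V ⊆ valueInterval F 𝒳 := by
    rintro _ ⟨g, hg, x, hx, rfl⟩
    exact ⟨iInf₂_le_of_le (fun x => (g x : EReal)) ⟨g, hg, rfl⟩ (iInf₂_le x hx),
      le_iSup₂_of_le (fun x => (g x : EReal)) ⟨g, hg, rfl⟩
        (le_iSup₂ (f := fun x (_ : x ∈ 𝒳) => (g x : EReal)) x hx)⟩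
  have hVc : Convex ℝ V := by
    refine convex_of_mul_mem ?_
    rintro _ ⟨g, hg, x, hx, rfl⟩ c hc0 hc1
    exact ⟨_, hF g hg c hc0 hc1, x, hx, rfl⟩
  have hlip : LipschitzOnWith B (fun s => (h s).toReal) V := by
    refine hVc.lipschitzOnWith_of_nnnorm_hasDerivWithin_le (f' := h')
      (fun t ht => (hh t (hVI ht)).2.2.mono hVI) ?_
    rintro _ ⟨g, hg, x, hx, rfl⟩
    exact hB g hg x hx
  obtain ⟨ψ, hψ, heq⟩ := hlip.extend_real
  refine ⟨ψ, hψ, fun g hg x hx => ?_⟩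
  have hmem : g x ∈ V := ⟨g, hg, x, hx, rfl⟩
  rw [← heq hmem]
  have := hh _ (hVI hmem)
  exact (EReal.coe_toReal this.1 this.2.1).symm

/-- The `k` neurons have weights at most `2a / k` and each costs at most `M * H`, so `k` cancels.
The bound `a₁` acts only through `M`. -/
theorem signedSum_netFun_le {a M B H a₁ a₄ : ℝ} (ha : 0 ≤ a) (hM : 0 ≤ M) (hB : 0 ≤ B)
    (hk : 1 ≤ k) {φ : ℝ → ℝ} (hφ : Monotone φ) {n : ℕ} (x : Fin n → Fin d → ℝ)
    (hφM : ∀ (w : Fin d → ℝ) (b : ℝ), max (∑ j, |w j|) |b| ≤ a₁ → ∀ i,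
      0 ≤ φ ((∑ j, w j * x i j) + b) ∧ φ ((∑ j, w j * x i j) + b) ≤ M)
    (hlin : ∀ w₀ : Fin d → ℝ, ∑ j, |w₀ j| ≤ a₄ → ∀ i, |∑ j, w₀ j * x i j| ≤ B)
    {ε : Fin n → ℤˣ} (hH : ∀ A ∈ halfSpaceTraces x, |signedSum ε (indVec A)| ≤ H)
    {θ : NetParam d k} (hθ : θ ∈ netParams d k a₁ (2 * (k : ℝ)⁻¹ * a) a a₄) :
    signedSum ε (fun i => netFun φ θ (x i)) ≤ (2 * a * M + 2 * B + a) * H := by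
  obtain ⟨h1, h2, h3, h4⟩ := hθ
  have hH0 : 0 ≤ H := (abs_nonneg _).trans (hH _ (empty_mem_halfSpaceTraces x))
  have hk0 : (0 : ℝ) < k := by exact_mod_cast hk
  have hrelu : Monotone reluAct := fun s t hst => max_le_max hst le_rfl
  have hlin' : ∀ w₀ : Fin d → ℝ, ∑ j, |w₀ j| ≤ a₄ →
      |signedSum ε (fun i => reluAct ((∑ j, w₀ j * x i j) + 0))| ≤ B * H := by
    intro w₀ hw₀
    refine abs_signedSum_comp_le hH hrelu w₀ 0 hB (fun i => le_max_right _ _) fun i => ?_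
    rw [add_zero]
    exact max_le ((le_abs_self _).trans (hlin w₀ hw₀ i)) hB
  have hneurons : |∑ l, θ.1 l * signedSum ε
      (fun i => φ ((∑ j, θ.2.1 l j * x i j) + θ.2.2.1 l))| ≤ 2 * a * M * H := by
    refine (Finset.abs_sum_le_sum_abs _ _).trans ?_
    have : ∀ l ∈ (Finset.univ : Finset (Fin k)), |θ.1 l * signedSum ε
        (fun i => φ ((∑ j, θ.2.1 l j * x i j) + θ.2.2.1 l))| ≤ 2 * (k : ℝ)⁻¹ * a * (M * H) := by
      intro l _
      rw [abs_mul]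
      exact mul_le_mul (h2 l) (abs_signedSum_comp_le hH hφ _ _ hM
        (fun i => (hφM _ _ (h1 l) i).1) fun i => (hφM _ _ (h1 l) i).2) (abs_nonneg _)
        (by positivity)
    refine (Finset.sum_le_sum this).trans_eq ?_
    rw [Finset.sum_const, Finset.card_univ, Fintype.card_fin, nsmul_eq_mul]
    field_simp
  have hone : |signedSum ε (fun _ => θ.2.2.2.2 * 1)| ≤ a * H := by
    rw [signedSum_mul, abs_mul]
    refine mul_le_mul h3 ?_ (abs_nonneg _) ha
    have := hH _ (univ_mem_halfSpaceTraces x)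
    simpa [indVec, signedSum] using this
  -- The level-set bound needs nonnegative monotone functions, so the linear part is split as
  -- `reluAct s - reluAct (-s)`. The constant part is a multiple of the full trace.
  have hdecomp : (fun i => netFun φ θ (x i)) = fun i =>
      ((∑ l, θ.1 l * φ ((∑ j, θ.2.1 l j * x i j) + θ.2.2.1 l)) +
        (reluAct ((∑ j, θ.2.2.2.1 j * x i j) + 0) -
          reluAct ((∑ j, (-θ.2.2.2.1) j * x i j) + 0))) + θ.2.2.2.2 * 1 := by
    funext i
    have e : ∀ s : ℝ, reluAct (s + 0) - reluAct (-s + 0) = s := by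
      intro s
      simp only [reluAct, add_zero]
      rcases le_total 0 s with hs | hs
      · rw [max_eq_left hs, max_eq_right (by linarith), sub_zero]
      · rw [max_eq_right hs, max_eq_left (by linarith)]; ring
    have e2 : ∑ j, (-θ.2.2.2.1) j * x i j = -∑ j, θ.2.2.2.1 j * x i j := by simp
    rw [e2, e, mul_one]
    rfl
  rw [hdecomp, signedSum_add, signedSum_add, signedSum_sub, signedSum_sum]
  simp only [signedSum_mul] at hone ⊢
  have hl1 := hlin' θ.2.2.2.1 h4
  have hl2 := hlin' (-θ.2.2.2.1) (by simpa using h4)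
  have b1 := (abs_le.1 hneurons).2
  have b2 := (abs_le.1 hl1).2
  have b3 := (abs_le.1 hl2).1
  have b4 := (abs_le.1 hone).2
  linarith

theorem expect_coe {α : Type*} [MeasurableSpace α] {μ : Measure α} {f : α → ℝ}
    (hf : Integrable f μ) : expect μ (fun x => (f x : EReal)) = ((∫ x, f x ∂μ : ℝ) : EReal) := by
  have h1 : ∫⁻ x, ENNReal.ofReal (f x) ∂μ ≠ ⊤ := hf.lintegral_lt_top.ne
  have h2 : ∫⁻ x, ENNReal.ofReal (-f x) ∂μ ≠ ⊤ := hf.neg.lintegral_lt_top.ne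
  rw [integral_eq_lintegral_pos_part_sub_lintegral_neg_part hf, EReal.coe_sub,
    EReal.coe_ennreal_toReal h1, EReal.coe_ennreal_toReal h2]
  simp only [expect, ← EReal.coe_neg, EReal.real_coe_toENNReal]

theorem coe_sum_ereal {κ : Type*} (s : Finset κ) (f : κ → ℝ) :
    ((∑ i ∈ s, f i : ℝ) : EReal) = ∑ i ∈ s, (f i : EReal) :=
  map_sum (⟨⟨Real.toEReal, EReal.coe_zero⟩, EReal.coe_add⟩ : ℝ →+ EReal) f s

theorem iSup_coe_ereal {κ : Type*} [Nonempty κ] {f : κ → ℝ} (hf : BddAbove (Set.range f)) :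
    ⨆ m, (f m : EReal) = ((⨆ m, f m : ℝ) : EReal) :=
  (Monotone.map_ciSup_of_continuousAt continuous_coe_real_ereal.continuousAt
    EReal.coe_strictMono.monotone hf).symm

end NeuralEstimation

/-! ### Assembly of the error bound -/

namespace NeuralEstimation

/-- The mean error of the estimator over a class of shallow networks with monotone activation. -/
theorem aemeasurable_estimator_and_lintegral_abs_sub_le {d k n : ℕ} (hk : 1 ≤ k) (hn : 1 ≤ n)
    {a a₁ a₄ M : ℝ} {B : ℝ≥0} (ha : 0 ≤ a) (ha₁ : 0 ≤ a₁) (ha₄ : 0 ≤ a₄) (hM : 0 ≤ M)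
    {φ : ℝ → ℝ} (hφ : Monotone φ) (hφc : Continuous φ) {𝒳 : Set (Fin d → ℝ)}
    {F : Set ((Fin d → ℝ) → ℝ)} (hF : F = nnClass d k a₁ (2 * (k : ℝ)⁻¹ * a) a a₄ φ)
    (hφM : ∀ (w : Fin d → ℝ) (b : ℝ), max (∑ j, |w j|) |b| ≤ a₁ → ∀ x ∈ 𝒳,
      0 ≤ φ ((∑ j, w j * x j) + b) ∧ φ ((∑ j, w j * x j) + b) ≤ M)
    (hvals : ∀ g ∈ F, ∀ x ∈ 𝒳, |g x| ≤ B) {h : ℝ → EReal} {ψ : ℝ → ℝ} (hψ : LipschitzWith B ψ)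
    (hhψ : ∀ g ∈ F, ∀ x ∈ 𝒳, h (g x) = (ψ (g x) : EReal))
    (μ ν : Measure 𝒳) [IsProbabilityMeasure μ] [IsProbabilityMeasure ν]
    {Ω : Type*} [MeasurableSpace Ω] (P : Measure Ω) {X Y : Fin n → Ω → 𝒳}
    (hX : HasLaw (fun ω i => X i ω) (Measure.pi fun _ => μ) P)
    (hY : HasLaw (fun ω i => Y i ω) (Measure.pi fun _ => ν) P) :
    AEMeasurable (fun ω => estimator h F (fun i => X i ω) (fun i => Y i ω)) P ∧
      ∫⁻ ω, (estimator h F (fun i => X i ω) (fun i => Y i ω) - divergence h F μ ν).abs ∂P ≤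
        ENNReal.ofReal ((n : ℝ)⁻¹ * (4 * (1 + B) *
          ((2 * a * M + 2 * B + a) * (20 * (d + 1) * Real.sqrt n)))) := by
  set Θ : Set (NetParam d k) := netParams d k a₁ (2 * (k : ℝ)⁻¹ * a) a a₄ with hΘ
  have hFimg : F = netFun φ '' Θ := hF.trans (nnClass_eq_image ..)
  have hmem : ∀ θ : Θ, netFun φ (θ : NetParam d k) ∈ F := fun θ => by
    rw [hFimg]
    exact ⟨θ, θ.2, rfl⟩
  have ha₂ : 0 ≤ 2 * (k : ℝ)⁻¹ * a := by positivity
  have hzero : (0 : NetParam d k) ∈ Θ :=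
    ⟨by simp [ha₁], by simp [ha₂], by simpa using ha, by simpa using ha₄⟩
  have hne : Nonempty Θ := ⟨⟨0, hzero⟩⟩
  let f : Θ → 𝒳 → ℝ := fun θ x => netFun φ (θ : NetParam d k) x
  have hfc : ∀ (θ : Θ) (x : 𝒳), |f θ x| ≤ B := fun θ x => hvals _ (hmem θ) x x.2
  have hfm : ∀ θ, Measurable (f θ) := fun θ =>
    (continuous_netFun hφc (θ : NetParam d k)).measurable.comp measurable_subtype_coe
  have hψf : ∀ θ, Measurable fun y => ψ (f θ y) := fun θ =>
    hψ.continuous.measurable.comp (hfm θ)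
  have hψc : ∀ θ x, |ψ (f θ x)| ≤ |ψ 0| + B * B := by
    intro θ x
    have h1 : |ψ (f θ x) - ψ 0| ≤ B * |f θ x - 0| := by
      simpa [Real.dist_eq] using hψ.dist_le_mul (f θ x) 0
    rw [sub_zero] at h1
    have h2 := mul_le_mul_of_nonneg_left (hfc θ x) B.coe_nonneg
    have h3 := abs_add_le (ψ (f θ x) - ψ 0) (ψ 0)
    rw [sub_add_cancel] at h3
    linarith
  have hlin : ∀ w₀ : Fin d → ℝ, ∑ j, |w₀ j| ≤ a₄ → ∀ x ∈ 𝒳, |∑ j, w₀ j * x j| ≤ B :=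
    fun w₀ hw₀ x hx => hvals _ (hF ▸ linear_mem_nnClass ha₁ ha₂ ha φ hw₀) x hx
  have hK : ∀ x : Fin n → 𝒳, ∀ s : Set Θ, s.Nonempty →
      ∑ ε : Fin n → ℤˣ, ⨆ θ : s, signedSum ε (fun i => f θ (x i)) ≤
        2 ^ n * ((2 * a * M + 2 * B + a) * (20 * (d + 1) * Real.sqrt n)) := by
    intro x s hs
    have : Nonempty s := hs.to_subtype
    obtain ⟨H, hH, hHsum⟩ := exists_halfSpace_bound (fun i => (x i : Fin d → ℝ))
      (by rw [Fintype.card_fin]; omega)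
    rw [Fintype.card_fin] at hHsum
    calc ∑ ε : Fin n → ℤˣ, ⨆ θ : s, signedSum ε (fun i => f θ (x i))
        ≤ ∑ ε, (2 * a * M + 2 * B + a) * H ε := by
          refine Finset.sum_le_sum fun ε _ => ciSup_le fun θ => ?_
          exact signedSum_netFun_le ha hM B.coe_nonneg hk hφ (fun i => (x i : Fin d → ℝ))
            (fun w b hwb i => hφM w b hwb _ (x i).2) (fun w₀ hw₀ i => hlin w₀ hw₀ _ (x i).2)
            (hH ε) θ.1.2
      _ = (2 * a * M + 2 * B + a) * ∑ ε, H ε := (Finset.mul_sum ..).symm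
      _ ≤ (2 * a * M + 2 * B + a) * (2 ^ n * (20 * (d + 1) * Real.sqrt n)) := by gcongr
      _ = _ := by ring
  obtain ⟨hmeas, hbound⟩ := aemeasurable_and_lintegral_enorm_sub_le hfm
    (fun x => (continuous_netFun_param hφc (x : Fin d → ℝ)).comp continuous_subtype_val) hfc
    (θ₀ := ⟨0, hzero⟩) (fun x => by simp [f, netFun]) hψ hn (by positivity) hK μ ν P hX hY
  have hest : ∀ x y : Fin n → 𝒳, estimator h F x y =
      ((⨆ θ, (n : ℝ)⁻¹ * ∑ i, (f θ (x i) - ψ (f θ (y i))) : ℝ) : EReal) := by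
    intro x y
    rw [← iSup_coe_ereal]
    · rw [estimator, hFimg, iSup_image, iSup_subtype']
      refine iSup_congr fun θ => ?_
      rw [EReal.coe_mul]
      congr 1
      have hterm : ∀ i, ((netFun φ (θ : NetParam d k) (x i) : ℝ) : EReal) -
          h (netFun φ (θ : NetParam d k) (y i)) =
          ((f θ (x i) - ψ (f θ (y i)) : ℝ) : EReal) := by
        intro i
        rw [hhψ _ (hmem θ) _ (y i).2, ← EReal.coe_sub]
      rw [Finset.sum_congr rfl fun i _ => hterm i, coe_sum_ereal]
    · refine ⟨(n : ℝ)⁻¹ * ∑ _i : Fin n, (B + (|ψ 0| + B * B)), ?_⟩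
      rintro _ ⟨θ, rfl⟩
      dsimp only
      gcongr with i
      have h1 := (abs_le.1 (hfc θ (x i))).2
      have h2 := (abs_le.1 (hψc θ (y i))).1
      linarith
  have hdiv : divergence h F μ ν =
      ((⨆ θ, (∫ x, f θ x ∂μ - ∫ y, ψ (f θ y) ∂ν) : ℝ) : EReal) := by
    rw [← iSup_coe_ereal]
    · rw [divergence, hFimg, iSup_image, iSup_subtype']
      refine iSup_congr fun θ => ?_
      rw [EReal.coe_sub]
      congr 1
      · exact expect_coe (Integrable.of_bound (hfm θ).aestronglyMeasurable _
          (Filter.Eventually.of_forall (hfc θ)))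
      · rw [← expect_coe (Integrable.of_bound (hψf θ).aestronglyMeasurable _
          (Filter.Eventually.of_forall (hψc θ)))]
        congr 1
        funext y
        exact hhψ _ (hmem θ) _ y.2
    · refine ⟨B + (|ψ 0| + B * B), ?_⟩
      rintro _ ⟨θ, rfl⟩
      dsimp only
      have h1 : ‖∫ x, f θ x ∂μ‖ ≤ B := by
        simpa using norm_integral_le_of_norm_le_const (μ := μ) (f := f θ)
          (Filter.Eventually.of_forall (hfc θ))
      have h2 : ‖∫ x, ψ (f θ x) ∂ν‖ ≤ |ψ 0| + B * B := by
        simpa using norm_integral_le_of_norm_le_const (μ := ν) (f := fun x => ψ (f θ x))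
          (Filter.Eventually.of_forall (hψc θ))
      have h1' := (abs_le.1 h1).2
      have h2' := (abs_le.1 h2).1
      linarith
  refine ⟨?_, ?_⟩
  · simp only [hest]
    exact hmeas.coe_real_ereal
  · simp only [hest, hdiv, ← EReal.coe_sub, EReal.abs_def]
    simpa only [← ofReal_norm, Real.norm_eq_abs] using hbound

/-- The dependence on `d` is linear, and `d + 1 ≤ 2 * d ^ (3 / 2)` for `d ≥ 1`; the constant is `160
= 4 * 20 * 2`. -/
theorem rate_le {d n : ℕ} (hd : 1 ≤ d) (hn : 1 ≤ n) {b c : ℝ} (hb : 0 ≤ b) (hc : 0 ≤ c) :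
    (n : ℝ)⁻¹ * (4 * b * (c * (20 * (d + 1) * Real.sqrt n))) ≤
      160 * b * c * (d : ℝ) ^ (3 / 2 : ℝ) * (n : ℝ) ^ (-(1 / 2) : ℝ) := by
  have hd1 : (1 : ℝ) ≤ d := by exact_mod_cast hd
  have hn0 : (0 : ℝ) < n := by exact_mod_cast hn
  have h1 : (d : ℝ) + 1 ≤ 2 * (d : ℝ) ^ (3 / 2 : ℝ) := by
    have := Real.rpow_le_rpow_of_exponent_le hd1 (show (1 : ℝ) ≤ 3 / 2 by norm_num)
    rw [Real.rpow_one] at this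
    linarith
  have h2 : (n : ℝ)⁻¹ * Real.sqrt n = (n : ℝ) ^ (-(1 / 2) : ℝ) := by
    rw [Real.sqrt_eq_rpow, ← Real.rpow_neg_one, ← Real.rpow_add hn0]
    norm_num
  calc (n : ℝ)⁻¹ * (4 * b * (c * (20 * (d + 1) * Real.sqrt n)))
      = 80 * b * c * (d + 1) * ((n : ℝ)⁻¹ * Real.sqrt n) := by ring
    _ ≤ 80 * b * c * (2 * (d : ℝ) ^ (3 / 2 : ℝ)) * ((n : ℝ)⁻¹ * Real.sqrt n) := by gcongr
    _ = _ := by rw [h2]; ring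

theorem le_of_upperC_le {E : Type*} {F : Set (E → ℝ)} {𝒳 : Set E} {u : ℝ → ℝ≥0∞} {B : ℝ≥0∞}
    (hB : upperC ((fun g x => u (g x)) '' F) 𝒳 ≤ B) {g : E → ℝ} (hg : g ∈ F) {x : E}
    (hx : x ∈ 𝒳) : u (g x) ≤ B :=
  le_trans (le_iSup₂_of_le (fun x => u (g x)) ⟨g, hg, rfl⟩
    (le_iSup₂ (f := fun x (_ : x ∈ 𝒳) => u (g x)) x hx)) hB

end NeuralEstimation

theorem theorem4 (a : ℝ) (ha : 0 < a)
    (G : (d k : ℕ) → Set ((Fin d → ℝ) → ℝ))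
    (hG : G = NeuralEstimation.reluClass a ∨ G = NeuralEstimation.sigmoidClass a)
    (h : ℝ → EReal) (R : ℝ≥0∞) (B : ℝ≥0) :
    ∃ C : ℝ, 0 < C ∧
      ∀ (d : ℕ), 1 ≤ d → ∀ (𝒳 : Set (Fin d → ℝ)), NeuralEstimation.setNorm 𝒳 = R →
      ∀ (h' : ℝ → ℝ),
        (∀ k : ℕ, 1 ≤ k →
          NeuralEstimation.HasDerivOn h h' (NeuralEstimation.valueInterval (G d k) 𝒳) ∧
          NeuralEstimation.upperC ((fun g x => ‖h' (g x)‖ₑ) '' G d k) 𝒳 ⊔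
            NeuralEstimation.upperC ((fun g x => (h (g x)).abs) '' G d k) 𝒳 ⊔
            NeuralEstimation.upperC ((fun g x => ‖g x‖ₑ) '' G d k) 𝒳 ≤ (B : ℝ≥0∞)) →
        ∀ (k n : ℕ), 1 ≤ k → 1 ≤ n →
        ∀ (μ ν : Measure 𝒳) [IsProbabilityMeasure μ] [IsProbabilityMeasure ν]
          {Ω : Type*} [MeasurableSpace Ω] (P : Measure Ω) [IsProbabilityMeasure P]
          (X Y : Fin n → Ω → 𝒳),
          (∀ i, HasLaw (X i) μ P) → iIndepFun X P →
          (∀ i, HasLaw (Y i) ν P) → iIndepFun Y P →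
          AEMeasurable (fun ω => NeuralEstimation.estimator h (G d k)
            (fun i => X i ω) (fun i => Y i ω)) P ∧
          ∫⁻ ω, (NeuralEstimation.estimator h (G d k) (fun i => X i ω) (fun i => Y i ω) -
              NeuralEstimation.divergence h (G d k) μ ν).abs ∂P ≤
            ENNReal.ofReal (C * (d : ℝ) ^ (3 / 2 : ℝ) * (n : ℝ) ^ (-(1 / 2) : ℝ)) := by
  open NeuralEstimation in
  -- A common bound for the neurons of both families. For ReLU, `a * (w ⬝ x)` is itself in the
  -- class, so `w ⬝ x ≤ B / a`, and the bias adds at most 1; the sigmoid is at most 1.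
  set M : ℝ := B / a + 1 with hM
  have hM0 : 0 ≤ M := by positivity
  refine ⟨160 * (1 + B) * (2 * a * M + 2 * B + a), by positivity, ?_⟩
  intro d hd 𝒳 _ h' hyp k n hk hn μ ν _ _ Ω _ P _ X Y hX hXi hY hYi
  obtain ⟨hder, hB⟩ := hyp k hk
  obtain ⟨hB12, hB3⟩ := sup_le_iff.1 hB
  obtain ⟨hB1, -⟩ := sup_le_iff.1 hB12
  have hvals : ∀ g ∈ G d k, ∀ x ∈ 𝒳, |g x| ≤ B := fun g hg x hx => by
    have := le_of_upperC_le (u := fun t => ‖t‖ₑ) hB3 hg hx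
    rw [enorm_le_coe] at this
    exact_mod_cast this
  have hder' : ∀ g ∈ G d k, ∀ x ∈ 𝒳, ‖h' (g x)‖₊ ≤ B := fun g hg x hx =>
    enorm_le_coe.1 (le_of_upperC_le (u := fun t => ‖h' t‖ₑ) hB1 hg hx)
  obtain ⟨a₁, a₄, φ, ha₁, ha₄, hφ, hφc, hF, hφM⟩ : ∃ (a₁ a₄ : ℝ) (φ : ℝ → ℝ), 0 ≤ a₁ ∧ 0 ≤ a₄ ∧
      Monotone φ ∧ Continuous φ ∧ G d k = nnClass d k a₁ (2 * (k : ℝ)⁻¹ * a) a a₄ φ ∧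
      ∀ (w : Fin d → ℝ) (b : ℝ), max (∑ j, |w j|) |b| ≤ a₁ → ∀ x ∈ 𝒳,
        0 ≤ φ ((∑ j, w j * x j) + b) ∧ φ ((∑ j, w j * x j) + b) ≤ M := by
    rcases hG with rfl | rfl
    · refine ⟨1, a, reluAct, zero_le_one, ha.le, fun s t hst => max_le_max hst le_rfl,
        continuous_id.max continuous_const, rfl, fun w b hwb x hx => ⟨le_max_right _ _, ?_⟩⟩
      obtain ⟨hw, hb⟩ := max_le_iff.1 hwb
      have hmem : (fun x : Fin d → ℝ => ∑ j, (a * w j) * x j) ∈ reluClass a d k := by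
        refine linear_mem_nnClass zero_le_one (by positivity) ha.le _ ?_
        simp only [abs_mul, abs_of_pos ha, ← Finset.mul_sum]
        exact mul_le_of_le_one_right ha.le hw
      have h1 := (abs_le.1 (hvals _ hmem x hx)).2
      simp only [mul_assoc, ← Finset.mul_sum] at h1
      have h2 : ∑ j, w j * x j ≤ B / a := (le_div_iff₀' ha).2 h1
      have h3 := (abs_le.1 hb).2
      exact max_le (by rw [hM]; linarith) hM0
    · refine ⟨_, 0, Real.sigmoid, mul_nonneg (Real.sqrt_nonneg _) (Real.log_natCast_nonneg k),
        le_rfl, Real.sigmoid_monotone, continuous_sigmoid, rfl, fun w b _ x _ =>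
        ⟨Real.sigmoid_nonneg _, (Real.sigmoid_le_one _).trans ?_⟩⟩
      rw [hM, le_add_iff_nonneg_left]
      positivity
  obtain ⟨ψ, hψ, hhψ⟩ := exists_lipschitzWith_eq
    (fun g hg c hc0 hc1 => hF ▸ smul_mem_nnClass (hF ▸ hg) hc0 hc1) hder hder'
  obtain ⟨h1, h2⟩ := aemeasurable_estimator_and_lintegral_abs_sub_le hk hn ha.le ha₁ ha₄ hM0 hφ
    hφc hF hφM hvals hψ hhψ μ ν P (hXi.hasLaw_pi hX) (hYi.hasLaw_pi hY)
  exact ⟨h1, h2.trans (ENNReal.ofReal_le_ofReal (rate_le hd hn (by positivity) (by positivity)))⟩
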